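/- Consider the following problem. The input is an integer $k$, a finite nonempty planar graph $G$ (given by its list of edges) and a set $\mathcal{D}$ of connected vertex sets of $G$ (each given by its list of elements); the task is to decide whether there are $k$ sets in $\mathcal{D}$ whose union is $V(G)$. Algorithms are deterministic random access machines, and running time is measured by the logarithmic cost. The Strong Exponential Time Hypothesis (SETH) states that for no $\epsilon>0$ and $c>0$ is there an algorithm that decides the satisfiability of every CNF formula (with clauses of arbitrary length) with $n$ variables and length $L$ in time $c\cdot(2-\epsilon)^n\cdot L^{c}$. Assume SETH. Then for every function $f:\mathbb{N}\to\mathbb{N}$ (in particular, for every computable one) and every $\epsilon>0$, there is no algorithm that solves this problem in time $f(k)\cdot(|\mathcal{D}|+|V(G)|)^{k-\epsilon}$. This holds even if the algorithm is required to work only for the parameter values $k$ in a given set $K\subseteq\mathbb{N}$ that contains some $k\ge 2$; for instance, only for one fixed $k\ge 2$. -/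

import Mathlib

/-! ### Random access machines with logarithmic cost -/

namespace RAM

/-- The arithmetic and bitwise operations of the machine (on natural numbers; subtraction is
truncated, division by zero gives zero). -/
inductive Op
  | add | sub | mul | div | mod | and | or | xor | shl | shr

def Op.eval : Op → ℕ → ℕ → ℕ
  | .add, a, b => a + b
  | .sub, a, b => a - b
  | .mul, a, b => a * b
  | .div, a, b => a / b
  | .mod, a, b => a % b
  | .and, a, b => a &&& b
  | .or, a, b => a ||| b
  | .xor, a, b => a ^^^ b
  | .shl, a, b => a <<< b
  | .shr, a, b => a >>> b

/-- Instructions. The arguments `r s t` name registers, `l` is a program line. -/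
inductive Instr
  /-- `R[r] := c` -/
  | const (r c : ℕ)
  /-- `R[r] := R[s] o R[t]` -/
  | op (o : Op) (r s t : ℕ)
  /-- `R[r] := M[R[s]]` -/
  | load (r s : ℕ)
  /-- `M[R[r]] := R[s]` -/
  | store (r s : ℕ)
  /-- if `R[r] = 0` then continue at line `l` -/
  | jz (r l : ℕ)

/-- A program is a finite list of instructions; it mentions only finitely many registers. -/
abbrev Program := List Instr

/-- A configuration: program counter, registers `R`, and the random access memory `M`. -/
structure Config where
  pc : ℕ
  reg : ℕ → ℕ
  mem : ℕ → ℕ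

/-- The effect of one instruction. -/
def Instr.exec : Instr → Config → Config
  | .const r c, σ => { σ with pc := σ.pc + 1, reg := Function.update σ.reg r c }
  | .op o r s t, σ =>
      { σ with pc := σ.pc + 1, reg := Function.update σ.reg r (o.eval (σ.reg s) (σ.reg t)) }
  | .load r s, σ =>
      { σ with pc := σ.pc + 1, reg := Function.update σ.reg r (σ.mem (σ.reg s)) }
  | .store r s, σ =>
      { σ with pc := σ.pc + 1, mem := Function.update σ.mem (σ.reg r) (σ.reg s) }
  | .jz r l, σ => { σ with pc := if σ.reg r = 0 then l else σ.pc + 1 }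

/-- The logarithmic cost of one instruction: one plus the bit lengths of all the numbers
(operands, results, memory addresses) that it handles. -/
def Instr.cost : Instr → Config → ℕ
  | .const _ c, _ => 1 + c.size
  | .op o _ s t, σ =>
      1 + (σ.reg s).size + (σ.reg t).size + (o.eval (σ.reg s) (σ.reg t)).size
  | .load _ s, σ => 1 + (σ.reg s).size + (σ.mem (σ.reg s)).size
  | .store r s, σ => 1 + (σ.reg r).size + (σ.reg s).size
  | .jz r _, σ => 1 + (σ.reg r).size

/-- `HaltsIn P σ t τ`: started in `σ`, the program `P` halts in the configuration `τ` after a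
computation of total cost `t`. A program halts when the program counter leaves it. -/
inductive HaltsIn (P : Program) : Config → ℕ → Config → Prop
  | halt (σ : Config) : P[σ.pc]? = none → HaltsIn P σ 0 σ
  | step (σ τ : Config) (i : Instr) (t : ℕ) : P[σ.pc]? = some i →
      HaltsIn P (i.exec σ) t τ → HaltsIn P σ (i.cost σ + t) τ

/-- The initial configuration: the input is written in the memory cells `0, 1, 2, …`, and all
other cells and all registers are zero. -/
def init (x : List ℕ) : Config where
  pc := 0
  reg := fun _ => 0
  mem := fun i => x.getD i 0

/-- On input `x`, the program `P` halts within time `T` and answers correctly whether `p` holds: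
register `0` finally holds `1` if `p` is true and `0` if `p` is false. -/
def DecidesWithin (P : Program) (x : List ℕ) (p : Prop) (T : ℝ) : Prop :=
  ∃ (t : ℕ) (τ : Config), HaltsIn P (init x) t τ ∧ (t : ℝ) ≤ T ∧
    (p → τ.reg 0 = 1) ∧ (¬ p → τ.reg 0 = 0)

end RAM

/-! ### CNF satisfiability and the Strong Exponential Time Hypothesis -/

/-- CNF formulas over the variables `0, …, n - 1`: lists of clauses, each of which is a list of
literals (variable, sign), of arbitrary length. -/
abbrev CNFFormula (n : ℕ) := List (List (Fin n × Bool))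

namespace CNFFormula

def Satisfiable {n : ℕ} (φ : CNFFormula n) : Prop :=
  ∃ a : Fin n → Bool, ∀ C ∈ φ, ∃ l ∈ C, a l.1 = l.2

/-- The input that represents `φ`: the number of variables, the number of clauses, and every clause
as its length followed by its literals. -/
def encode {n : ℕ} (φ : CNFFormula n) : List ℕ :=
  n :: φ.length ::
    φ.flatMap fun C => C.length :: C.map fun l => 2 * (l.1 : ℕ) + l.2.toNat

end CNFFormula

/-- The Strong Exponential Time Hypothesis: for no `ε > 0` can the satisfiability of `n`-variable
CNF formulas be decided in time `(2 - ε) ^ n`, up to a factor polynomial in the length of the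
formula. -/
def SETH : Prop :=
  ∀ ε : ℝ, 0 < ε → ε < 1 →
    ¬ ∃ (P : RAM.Program) (c : ℕ), ∀ (n : ℕ) (φ : CNFFormula n),
      RAM.DecidesWithin P φ.encode φ.Satisfiable
        (c * (2 - ε) ^ n * (φ.encode.length : ℝ) ^ c)

/-! ### Covering a planar graph by connected vertex sets -/

/-- A graph is planar if it can be drawn in the plane: the vertices are distinct points, every edge
is a simple arc between its endpoints, an arc contains no vertex besides its endpoints, and two
different arcs meet only in common endpoints. -/
def SimpleGraph.IsPlanar {V : Type*} (G : SimpleGraph V) : Prop :=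
  ∃ (pt : V → ℝ × ℝ) (arc : Sym2 V → Set (ℝ × ℝ)),
    Function.Injective pt ∧
    (∀ u v, G.Adj u v → ∃ γ : _root_.Path (pt u) (pt v),
      Function.Injective γ ∧ Set.range γ = arc s(u, v)) ∧
    (∀ e ∈ G.edgeSet, ∀ w, pt w ∈ arc e → w ∈ e) ∧
    (∀ e ∈ G.edgeSet, ∀ e' ∈ G.edgeSet, e ≠ e' →
      ∀ z ∈ arc e ∩ arc e', ∃ w, w ∈ e ∧ w ∈ e' ∧ pt w = z)

/-- A (nonempty, finite) planar graph `G` with a set `Obj` of connected vertex sets. -/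
structure PlanarCoverInstance where
  n : ℕ
  n_pos : 0 < n
  G : SimpleGraph (Fin n)
  planar : G.IsPlanar
  Obj : Finset (Finset (Fin n))
  connected : ∀ S ∈ Obj, (G.induce (S : Set (Fin n))).Connected

namespace PlanarCoverInstance

/-- There are `k` sets in `Obj` whose union is the whole vertex set. -/
def HasCover (I : PlanarCoverInstance) (k : ℕ) : Prop :=
  ∃ F ⊆ I.Obj, F.card = k ∧ ∀ v, ∃ S ∈ F, v ∈ S

/-- `x` represents the instance `I` with parameter `k`: it lists `k`, the number of vertices, the
number of edges, the edges (each once, as a pair with the smaller endpoint first), the number of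
sets, and the sets (each once, as its size followed by its elements). Edges, sets and the elements
of a set may come in any order. -/
def IsEncoding (I : PlanarCoverInstance) (k : ℕ) (x : List ℕ) : Prop :=
  ∃ (es : List (Fin I.n × Fin I.n)) (ss : List (List (Fin I.n))),
    es.Nodup ∧ (∀ u v, (u, v) ∈ es ↔ u < v ∧ I.G.Adj u v) ∧
    (∀ s ∈ ss, s.Nodup) ∧ (ss.map List.toFinset).Nodup ∧
    (∀ S, S ∈ ss.map List.toFinset ↔ S ∈ I.Obj) ∧
    x = [k, I.n, es.length] ++ es.flatMap (fun e => [(e.1 : ℕ), (e.2 : ℕ)]) ++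
      [ss.length] ++ ss.flatMap (fun s => s.length :: s.map fun v => (v : ℕ))

end PlanarCoverInstance

/-!
Split the `n` variables of a CNF formula into `k` groups of `g ≈ n / k` variables. Take a star, with
a leaf for every group, every variable and every clause, and for each of the `2 ^ g` partial
assignments of each group the set of the center, the leaf of the group, the leaves of the clauses
made true by the partial assignment, and the leaves of the variables not made false by it. A star
is planar, and all these sets are connected because they contain the center. If `k` of the sets
cover the star, then they contain exactly one set for each group, since the leaf of the group has to
be covered, and so form an assignment; the leaf of a clause is covered if and only if this
assignment satisfies the clause. The leaves of the variables serve to make the sets different. They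
are always covered, since for `k ≥ 2` there is a group to which a given variable does not belong.

There are `k * 2 ^ g` sets, so that an algorithm with exponent `k - ε` decides satisfiability in
time `2 ^ ((1 - ε / k) * n)`, up to polynomial factors, which contradicts the SETH. The computation
of the instance is programmed in a language of bounded loops, in which no number exceeds the sum of
the running time and a bound on the initial numbers, so that all machine instructions have
logarithmic cost `O(g + log L)`; a compiler turns it into a program of the machine.
-/

/-! ### Stars -/

section Star

variable {V : Type*}

open Classical in
/-- The drawing of a star with center `r`: the center is the origin, and the leaves lie on a
vertical line, at pairwise different heights `h`. -/
noncomputable def starPoint (r : V) (h : V → ℝ) (v : V) : ℝ × ℝ :=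
  if v = r then (0, 0) else (1, h v)

/-- The arc that draws the edge `e` of a star with center `r`: the straight segment from the origin
to the leaf of `e`. -/
def starArc (r : V) (h : V → ℝ) (e : Sym2 V) : Set (ℝ × ℝ) :=
  {z | ∃ v ∈ e, v ≠ r ∧ ∃ t ∈ Set.Icc (0 : ℝ) 1, z = (t, t * h v)}

variable {r : V} {h : V → ℝ}

theorem starPoint_center : starPoint r h r = (0, 0) := if_pos rfl

theorem starPoint_of_ne {v : V} (hv : v ≠ r) : starPoint r h v = (1, h v) := if_neg hv

theorem starPoint_injective (hh : Function.Injective h) : Function.Injective (starPoint r h) := by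
  intro u v huv
  by_cases hu : u = r <;> by_cases hv : v = r
  · rw [hu, hv]
  · simp [hu, starPoint_center, starPoint_of_ne hv] at huv
  · simp [hv, starPoint_center, starPoint_of_ne hu] at huv
  · exact hh (by simpa [starPoint_of_ne hu, starPoint_of_ne hv] using huv)

theorem mem_starArc {v : V} (hv : v ≠ r) {z : ℝ × ℝ} :
    z ∈ starArc r h s(r, v) ↔ ∃ t ∈ Set.Icc (0 : ℝ) 1, z = (t, t * h v) := by
  constructor
  · rintro ⟨w, hw, hwr, hz⟩
    obtain rfl : w = v := by simpa [hwr] using hw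
    exact hz
  · exact fun hz => ⟨v, Sym2.mem_mk_right r v, hv, hz⟩

theorem exists_path_range_eq_starArc {v : V} (hv : v ≠ r) :
    ∃ γ : _root_.Path (starPoint r h r) (starPoint r h v),
      Function.Injective γ ∧ Set.range γ = starArc r h s(r, v) := by
  refine ⟨⟨⟨fun t => ((t : ℝ), (t : ℝ) * h v), by fun_prop⟩, ?_, ?_⟩, ?_, ?_⟩
  · simp [starPoint_center]
  · simp [starPoint_of_ne hv]
  · exact fun s t hst => Subtype.ext (congrArg Prod.fst hst)
  · ext z
    rw [mem_starArc hv]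
    exact ⟨fun ⟨t, ht⟩ => ⟨t, t.2, ht.symm⟩, fun ⟨t, ht, hz⟩ => ⟨⟨t, ht⟩, hz.symm⟩⟩

theorem exists_eq_of_mem_edgeSet_starGraph {e : Sym2 V}
    (he : e ∈ (SimpleGraph.starGraph r).edgeSet) : ∃ v, v ≠ r ∧ e = s(r, v) := by
  induction e with | _ u v
  obtain ⟨huv, rfl | rfl⟩ := SimpleGraph.starGraph_adj.1 he
  · exact ⟨v, huv.symm, rfl⟩
  · exact ⟨u, huv, Sym2.eq_swap⟩

theorem eq_of_starPoint_mem_starArc (hh : Function.Injective h) {u v : V} (hv : v ≠ r)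
    (hu : u ≠ r) (huv : starPoint r h u ∈ starArc r h s(r, v)) : u = v := by
  obtain ⟨t, -, ht⟩ := (mem_starArc hv).1 huv
  rw [starPoint_of_ne hu, Prod.mk.injEq] at ht
  obtain ⟨rfl, ht⟩ := ht
  exact hh (by simpa using ht)

theorem eq_starPoint_center_of_mem_starArc (hh : Function.Injective h) {u v : V} (hu : u ≠ r)
    (hv : v ≠ r) (huv : u ≠ v) {z : ℝ × ℝ} (hzu : z ∈ starArc r h s(r, u))
    (hzv : z ∈ starArc r h s(r, v)) : z = starPoint r h r := by
  obtain ⟨t, -, rfl⟩ := (mem_starArc hu).1 hzu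
  obtain ⟨t', -, ht⟩ := (mem_starArc hv).1 hzv
  rw [Prod.mk.injEq] at ht
  obtain ⟨rfl, ht⟩ := ht
  rcases mul_eq_mul_left_iff.1 ht with huv' | rfl
  · exact absurd (hh huv') huv
  · simp [starPoint_center]

theorem isPlanar_starGraph (r : V) (hh : Function.Injective h) :
    (SimpleGraph.starGraph r).IsPlanar := by
  refine ⟨starPoint r h, starArc r h, starPoint_injective hh, fun u v huv => ?_,
    fun e he w hw => ?_, fun e he e' he' hne z hz => ?_⟩
  · obtain ⟨hne, rfl | rfl⟩ := SimpleGraph.starGraph_adj.1 huv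
    · exact exists_path_range_eq_starArc hne.symm
    · obtain ⟨γ, hγ, hrange⟩ := exists_path_range_eq_starArc (h := h) hne
      exact ⟨γ.symm, hγ.comp unitInterval.symm_bijective.injective, by
        rw [_root_.Path.symm_range, hrange, Sym2.eq_swap]⟩
  · obtain ⟨v, hv, rfl⟩ := exists_eq_of_mem_edgeSet_starGraph he
    by_cases hwr : w = r
    · simp [hwr]
    · simp [eq_of_starPoint_mem_starArc hh hv hwr hw]
  · obtain ⟨u, hu, rfl⟩ := exists_eq_of_mem_edgeSet_starGraph he
    obtain ⟨v, hv, rfl⟩ := exists_eq_of_mem_edgeSet_starGraph he'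
    refine ⟨r, by simp, by simp, (eq_starPoint_center_of_mem_starArc hh hu hv ?_ hz.1 hz.2).symm⟩
    exact fun huv => hne (by rw [huv])

theorem connected_induce_starGraph {S : Set V} (hr : r ∈ S) :
    ((SimpleGraph.starGraph r).induce S).Connected := by
  have reachable_center (v : S) : ((SimpleGraph.starGraph r).induce S).Reachable ⟨r, hr⟩ v := by
    by_cases hv : r = v
    · rw [show v = ⟨r, hr⟩ from Subtype.ext hv.symm]
    · exact SimpleGraph.Adj.reachable (SimpleGraph.starGraph_center_adj hv)
  exact { preconnected := fun u v => (reachable_center u).symm.trans (reachable_center v)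
          nonempty := ⟨⟨r, hr⟩⟩ }

end Star

/-- The vertex set of a star with `N` leaves that is listed by `s`. -/
def vertexSet (N : ℕ) (s : List ℕ) : Finset (Fin (N + 1)) :=
  Finset.univ.filter fun v => (v : ℕ) ∈ s

theorem mem_vertexSet {N : ℕ} {s : List ℕ} {v : Fin (N + 1)} :
    v ∈ vertexSet N s ↔ (v : ℕ) ∈ s := by
  simp [vertexSet]

theorem vertexSet_map_val {N : ℕ} (s : List (Fin (N + 1))) :
    vertexSet N (s.map Fin.val) = s.toFinset := by
  ext v
  simp [mem_vertexSet, Fin.val_inj]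

/-- The star with center `0` and `N` leaves, to be covered by the vertex sets listed in `ls`. -/
def starInstance (N : ℕ) (ls : List (List ℕ)) (hls : ∀ s ∈ ls, 0 ∈ s) : PlanarCoverInstance where
  n := N + 1
  n_pos := Nat.succ_pos N
  G := SimpleGraph.starGraph 0
  planar := isPlanar_starGraph 0 (h := fun v : Fin (N + 1) => ((v : ℕ) : ℝ))
    (Nat.cast_injective.comp Fin.val_injective)
  Obj := (ls.map (vertexSet N)).toFinset
  connected := by
    intro S hS
    obtain ⟨s, hs, rfl⟩ := List.mem_map.1 (List.mem_toFinset.1 hS)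
    exact connected_induce_starGraph (mem_vertexSet.2 (hls s hs))

/-- The list that represents the star with `N` leaves, the vertex sets in `ls` and the
parameter `k`. -/
def starEncoding (k N : ℕ) (ls : List (List ℕ)) : List ℕ :=
  [k, N + 1, N] ++ (List.range N).flatMap (fun v => [0, v + 1]) ++ [ls.length] ++
    ls.flatMap fun s => s.length :: s

theorem mem_starEdges {N : ℕ} {u v : Fin (N + 1)} :
    (u, v) ∈ (List.finRange N).map (fun x => ((0 : Fin (N + 1)), x.succ)) ↔
      u < v ∧ (SimpleGraph.starGraph 0).Adj u v := by
  simp only [List.mem_map, List.mem_finRange, true_and, Prod.mk.injEq, SimpleGraph.starGraph_adj]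
  constructor
  · rintro ⟨x, rfl, rfl⟩
    exact ⟨Fin.succ_pos x, (Fin.succ_pos x).ne, Or.inl rfl⟩
  · rintro ⟨hlt, -, rfl | rfl⟩
    · exact ⟨v.pred hlt.ne', rfl, Fin.succ_pred v _⟩
    · exact absurd hlt (Fin.not_lt_zero u)

theorem isEncoding_starEncoding (k : ℕ) {N : ℕ} {ls : List (List ℕ)} (hls : ∀ s ∈ ls, 0 ∈ s)
    (hlt : ∀ s ∈ ls, ∀ v ∈ s, v < N + 1) (hs : ∀ s ∈ ls, s.Nodup)
    (hnodup : (ls.map (vertexSet N)).Nodup) :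
    (starInstance N ls hls).IsEncoding k (starEncoding k N ls) := by
  lift ls to List (List (Fin (N + 1))) using hlt
  have hmap : (ls.map (List.map Fin.val)).map (vertexSet N) = ls.map List.toFinset := by
    simp only [List.map_map, Function.comp_def, vertexSet_map_val]
  refine ⟨(List.finRange N).map fun x => ((0 : Fin (N + 1)), x.succ), ls, ?_,
    fun u v => mem_starEdges, fun s h => ?_, ?_, fun S => ?_, ?_⟩
  · exact (List.nodup_finRange N).map fun u v h => Fin.succ_injective _ (congrArg Prod.snd h)
  · exact (hs _ (List.mem_map_of_mem h)).of_map
  · exact hmap ▸ hnodup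
  · exact (iff_of_eq (congrArg (S ∈ ·) hmap.symm)).trans List.mem_toFinset.symm
  · have map_val (s : List (Fin (N + 1))) :
        s.map Fin.val = s.flatMap fun v : Fin (N + 1) => [(v : ℕ)] := List.map_eq_flatMap
    simp [starEncoding, starInstance, List.flatMap_map, ← List.map_coe_finRange_eq_range, map_val]

theorem hasCover_starInstance {k N : ℕ} {ls : List (List ℕ)} (hls : ∀ s ∈ ls, 0 ∈ s) :
    (starInstance N ls hls).HasCover k ↔
      ∃ F ⊆ (ls.map (vertexSet N)).toFinset, F.card = k ∧ ∀ v, ∃ S ∈ F, v ∈ S :=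
  Iff.rfl

/-! ### Satisfiability as a covering problem -/

/-- To cover `p i`, one of the sets `A i w` is needed for every `i`, and there is no room for
more. -/
theorem exists_card_eq_cover_iff {V W ι : Type*} [Fintype ι] {A : ι → W → Finset V}
    {p : ι → V} (hp : ∀ i j w, p i ∈ A j w ↔ i = j) {O : Finset (Finset V)}
    (hO : ∀ S, S ∈ O ↔ ∃ i w, A i w = S) :
    (∃ F ⊆ O, F.card = Fintype.card ι ∧ ∀ v, ∃ S ∈ F, v ∈ S) ↔
      ∃ w : ι → W, ∀ v, ∃ i, v ∈ A i (w i) := by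
  classical
  have injective_choice (w : ι → W) : Function.Injective fun i => A i (w i) := by
    intro i j hij
    exact (hp i j (w j)).1 ((Finset.ext_iff.1 hij (p i)).1 ((hp i i (w i)).2 rfl))
  have card_choice (w : ι → W) :
      (Finset.univ.image fun i => A i (w i)).card = Fintype.card ι := by
    rw [Finset.card_image_of_injective _ (injective_choice w), Finset.card_univ]
  constructor
  · rintro ⟨F, hF, hcard, hcover⟩
    have exists_mem (i : ι) : ∃ w, A i w ∈ F := by
      obtain ⟨S, hS, hpS⟩ := hcover (p i)
      obtain ⟨j, w, rfl⟩ := (hO S).1 (hF hS)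
      obtain rfl := (hp i j w).1 hpS
      exact ⟨w, hS⟩
    choose w hw using exists_mem
    have image_eq : (Finset.univ.image fun i => A i (w i)) = F := by
      refine Finset.eq_of_subset_of_card_le (Finset.image_subset_iff.2 fun i _ => hw i) ?_
      rw [card_choice, hcard]
    refine ⟨w, fun v => ?_⟩
    simpa [← image_eq] using hcover v
  · rintro ⟨w, hw⟩
    refine ⟨Finset.univ.image fun i => A i (w i), ?_, card_choice w, fun v => ?_⟩
    · exact Finset.image_subset_iff.2 fun i _ => (hO _).2 ⟨i, w i, rfl⟩
    · simpa using hw v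

namespace SatCover

/-- The variables are split into groups of `g` consecutive ones. `agrees g i w t` says that the
literal with code `t` belongs to a variable of group `i` and is made true by the partial assignment
that gives the variables of this group the binary digits of `w`. -/
def agrees (g i w t : ℕ) : Bool :=
  decide (t / 2 / g = i ∧ (w.testBit (t / 2 % g)).toNat = t % 2)

/-- The leaves that stand for the variables not made false by the partial assignment `w` of group
`i`. Between them they determine `w`. -/
def variableLeaves (k g i w : ℕ) : List ℕ :=
  ((List.range (k * g)).filter fun x => !agrees g i w (2 * x)).map (k + 1 + ·)

/-- The leaves that stand for the clauses made true by the partial assignment `w` of group `i`;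
the clauses are given as lists of codes of literals. -/
def clauseLeaves (k g : ℕ) (cs : List (List ℕ)) (i w : ℕ) : List ℕ :=
  ((List.range cs.length).filter fun j => (cs.getD j []).any (agrees g i w)).map
    (k + 1 + k * g + ·)

/-- The set that stands for the partial assignment `w` of group `i`: the center `0`, the leaf
`i + 1` of the group, and the leaves of some variables and clauses. -/
def members (k g : ℕ) (cs : List (List ℕ)) (i w : ℕ) : List ℕ :=
  0 :: (i + 1) :: (variableLeaves k g i w ++ clauseLeaves k g cs i w)

/-- The number of leaves of the star: one for every group, every variable and every clause. -/
def leaves (k g : ℕ) (cs : List (List ℕ)) : ℕ := k + k * g + cs.length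

/-- The sets that stand for all partial assignments of all groups. -/
def objects (k g : ℕ) (cs : List (List ℕ)) : List (List ℕ) :=
  (List.range k).flatMap fun i => (List.range (2 ^ g)).map (members k g cs i)

variable {k g : ℕ} {cs : List (List ℕ)} {i w : ℕ}

theorem mem_members {v : ℕ} : v ∈ members k g cs i w ↔ v = 0 ∨ v = i + 1 ∨
    (∃ x < k * g, agrees g i w (2 * x) = false ∧ k + 1 + x = v) ∨
    ∃ j < cs.length, (cs.getD j []).any (agrees g i w) ∧ k + 1 + k * g + j = v := by
  simp only [members, variableLeaves, clauseLeaves, List.mem_cons, List.mem_append, List.mem_map,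
    List.mem_filter, List.mem_range, Bool.not_eq_true', and_assoc]

theorem group_mem_members {j : ℕ} (hj : j < k) : j + 1 ∈ members k g cs i w ↔ j = i := by
  grind [mem_members]

theorem agrees_two_mul {x : ℕ} :
    agrees g i w (2 * x) = false ↔ (x / g = i → w.testBit (x % g) = true) := by
  simp [agrees]

theorem variable_mem_members {x : ℕ} (hi : i < k) (hx : x < k * g) :
    k + 1 + x ∈ members k g cs i w ↔ (x / g = i → w.testBit (x % g) = true) := by
  rw [← agrees_two_mul]
  grind [mem_members]

theorem clause_mem_members {j : ℕ} (hi : i < k) (hj : j < cs.length) :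
    k + 1 + k * g + j ∈ members k g cs i w ↔ ∃ t ∈ cs[j], agrees g i w t := by
  have any_getD : (cs.getD j []).any (agrees g i w) ↔ ∃ t ∈ cs[j], agrees g i w t := by
    simp [hj]
  grind [mem_members]

theorem lt_of_mem_members {v : ℕ} (hi : i < k) (hv : v ∈ members k g cs i w) :
    v < leaves k g cs + 1 := by
  grind [mem_members, leaves]

theorem mem_Ico_of_mem_variableLeaves {v : ℕ} (hv : v ∈ variableLeaves k g i w) :
    v ∈ Set.Ico (k + 1) (k + 1 + k * g) := by
  simp only [variableLeaves, List.mem_map, List.mem_filter, List.mem_range] at hv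
  obtain ⟨x, ⟨hx, -⟩, rfl⟩ := hv
  exact ⟨by omega, by omega⟩

theorem le_of_mem_clauseLeaves {v : ℕ} (hv : v ∈ clauseLeaves k g cs i w) : k + 1 + k * g ≤ v := by
  obtain ⟨j, -, rfl⟩ := List.mem_map.1 hv
  omega

theorem nodup_members (hi : i < k) : (members k g cs i w).Nodup := by
  have hvariable : (variableLeaves k g i w).Nodup :=
    (List.nodup_range.filter _).map (add_right_injective _)
  have hclause : (clauseLeaves k g cs i w).Nodup :=
    (List.nodup_range.filter _).map (add_right_injective _)
  have lt_of_mem (v : ℕ) (hv : v ∈ variableLeaves k g i w ++ clauseLeaves k g cs i w) : k < v := by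
    rcases List.mem_append.1 hv with hv | hv
    · exact (mem_Ico_of_mem_variableLeaves hv).1
    · have := le_of_mem_clauseLeaves hv
      omega
  have hdisj : (variableLeaves k g i w).Disjoint (clauseLeaves k g cs i w) := fun v hv hv' =>
    (mem_Ico_of_mem_variableLeaves hv).2.not_ge (le_of_mem_clauseLeaves hv')
  have h1 : i + 1 ∉ variableLeaves k g i w ++ clauseLeaves k g cs i w := fun h => by
    have := lt_of_mem _ h
    omega
  have h0 : 0 ∉ (i + 1) :: (variableLeaves k g i w ++ clauseLeaves k g cs i w) := fun h => by
    have := lt_of_mem 0 (by simpa using h)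
    omega
  exact List.nodup_cons.2 ⟨h0, List.nodup_cons.2 ⟨h1, hvariable.append hclause hdisj⟩⟩

theorem exists_of_lt_leaves {v : ℕ} (hv : v < leaves k g cs + 1) : v = 0 ∨ (∃ i < k, v = i + 1) ∨
    (∃ x < k * g, v = k + 1 + x) ∨ ∃ j < cs.length, v = k + 1 + k * g + j := by
  by_cases h1 : v < k + 1
  · rcases v with _ | i
    · exact Or.inl rfl
    · exact Or.inr (Or.inl ⟨i, by omega, rfl⟩)
  by_cases h2 : v < k + 1 + k * g
  · exact Or.inr (Or.inr (Or.inl ⟨v - (k + 1), by omega⟩))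
  · exact Or.inr (Or.inr (Or.inr ⟨v - (k + 1 + k * g), by grind [leaves]⟩))

theorem div_lt_of_lt_mul {x : ℕ} (hx : x < k * g) : x / g < k :=
  Nat.div_lt_of_lt_mul (by rwa [mul_comm] at hx)

theorem members_injective {i' w' : ℕ} (hi : i < k) (hi' : i' < k) (hw : w < 2 ^ g)
    (hw' : w' < 2 ^ g) (h : vertexSet (leaves k g cs) (members k g cs i w) =
      vertexSet (leaves k g cs) (members k g cs i' w')) : i = i' ∧ w = w' := by
  have mem_iff (v : ℕ) (hv : v < leaves k g cs + 1) :
      v ∈ members k g cs i w ↔ v ∈ members k g cs i' w' := by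
    simpa only [mem_vertexSet] using Finset.ext_iff.1 h ⟨v, hv⟩
  obtain rfl : i = i' := by
    have := mem_iff (i + 1) (by grind [leaves])
    rw [group_mem_members hi, group_mem_members hi] at this
    exact this.1 rfl
  refine ⟨rfl, Nat.eq_of_testBit_eq fun c => ?_⟩
  by_cases hc : c < g
  · have hx : i * g + c < k * g := by nlinarith
    have hdiv : (i * g + c) / g = i := by
      rw [mul_comm, Nat.mul_add_div (by omega), Nat.div_eq_of_lt hc, add_zero]
    have hmod : (i * g + c) % g = c := by rw [mul_comm, Nat.mul_add_mod, Nat.mod_eq_of_lt hc]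
    have := mem_iff (k + 1 + (i * g + c)) (by grind [leaves])
    rw [variable_mem_members hi hx, variable_mem_members hi hx, hdiv, hmod] at this
    simpa only [true_imp_iff, ← Bool.eq_iff_iff] using this
  · have hpow : 2 ^ g ≤ 2 ^ c := Nat.pow_le_pow_right two_pos (not_lt.1 hc)
    rw [Nat.testBit_lt_two_pow (hw.trans_le hpow), Nat.testBit_lt_two_pow (hw'.trans_le hpow)]

theorem mem_objects {s : List ℕ} :
    s ∈ objects k g cs ↔ ∃ i < k, ∃ w < 2 ^ g, members k g cs i w = s := by
  simp [objects]

theorem length_objects : (objects k g cs).length = k * 2 ^ g := by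
  simp [objects, List.length_flatMap]

theorem nodup_map_vertexSet_objects :
    ((objects k g cs).map (vertexSet (leaves k g cs))).Nodup := by
  rw [objects, List.map_flatMap, List.nodup_flatMap]
  refine ⟨fun i hi => ?_, List.nodup_range.imp_of_mem fun {i i'} hi hi' hne => ?_⟩
  · rw [List.map_map]
    refine List.nodup_range.map_on fun w hw w' hw' h => ?_
    rw [List.mem_range] at hi hw hw'
    exact (members_injective hi hi hw hw' h).2
  · simp only [Function.onFun, List.disjoint_left, List.mem_map, List.mem_range] at hi hi' ⊢
    rintro _ ⟨_, ⟨w, hw, rfl⟩, rfl⟩ ⟨_, ⟨w', hw', rfl⟩, h⟩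
    exact hne (members_injective hi' hi hw' hw h).1.symm

/-- The clauses of a formula, as lists of codes of literals. -/
def codes {n : ℕ} (φ : CNFFormula n) : List (List ℕ) :=
  φ.map fun C => C.map fun l => 2 * (l.1 : ℕ) + l.2.toNat

/-- The encoding of a formula with `n` variables and the clauses `cs`. -/
def cnfEncoding (n : ℕ) (cs : List (List ℕ)) : List ℕ :=
  n :: cs.length :: cs.flatMap fun c => c.length :: c

theorem encode_eq_cnfEncoding {n : ℕ} (φ : CNFFormula n) :
    φ.encode = cnfEncoding n (codes φ) := by
  simp [CNFFormula.encode, cnfEncoding, codes, List.flatMap_map]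

theorem agrees_code {n : ℕ} (l : Fin n × Bool) :
    agrees g i w (2 * (l.1 : ℕ) + l.2.toNat) ↔
      (l.1 : ℕ) / g = i ∧ w.testBit ((l.1 : ℕ) % g) = l.2 := by
  have hdiv : (2 * (l.1 : ℕ) + l.2.toNat) / 2 = l.1 := by cases l.2 <;> simp; omega
  have hmod : (2 * (l.1 : ℕ) + l.2.toNat) % 2 = l.2.toNat := by cases l.2 <;> simp
  rw [agrees, hdiv, hmod]
  cases l.2 <;> simp

variable {n : ℕ} {φ : CNFFormula n}

theorem clause_mem_members_codes (hi : i < k) {j : ℕ} (hj : j < φ.length) :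
    k + 1 + k * g + j ∈ members k g (codes φ) i w ↔
      ∃ l ∈ φ[j], (l.1 : ℕ) / g = i ∧ w.testBit ((l.1 : ℕ) % g) = l.2 := by
  rw [clause_mem_members hi (by simpa [codes] using hj)]
  simp [codes, -Prod.exists, agrees_code]

theorem satisfiable_of_covers (hg : n ≤ k * g) {w : Fin k → ℕ}
    (hw : ∀ v < leaves k g (codes φ) + 1, ∃ i : Fin k, v ∈ members k g (codes φ) i (w i)) :
    φ.Satisfiable := by
  refine ⟨fun x => (w ⟨x / g, div_lt_of_lt_mul (x.2.trans_le hg)⟩).testBit (x % g), fun C hC => ?_⟩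
  obtain ⟨j, hj, rfl⟩ := List.getElem_of_mem hC
  obtain ⟨i, hi⟩ := hw (k + 1 + k * g + j) (by grind [leaves, codes])
  obtain ⟨l, hl, hli, hbit⟩ := (clause_mem_members_codes i.2 hj).1 hi
  refine ⟨l, hl, ?_⟩
  simpa only [hli] using hbit

theorem exists_testBit_eq (g : ℕ) (b : ℕ → Bool) : ∃ w < 2 ^ g, ∀ c < g, w.testBit c = b c :=
  ⟨Nat.ofBits fun c : Fin g => b c, Nat.ofBits_lt_two_pow _, fun _ => Nat.testBit_ofBits_lt _ _⟩

theorem exists_covers_of_satisfiable (hk : 2 ≤ k) (hg : n ≤ k * g) (hφ : φ.Satisfiable) :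
    ∃ w : Fin k → Fin (2 ^ g), ∀ v < leaves k g (codes φ) + 1, ∃ i : Fin k,
      v ∈ members k g (codes φ) i (w i) := by
  obtain ⟨a, ha⟩ := hφ
  let b (x : ℕ) : Bool := if h : x < n then a ⟨x, h⟩ else false
  choose w hw hbit using fun i => exists_testBit_eq g fun c => b (i * g + c)
  refine ⟨fun i => ⟨w i, hw i⟩, fun v hv => ?_⟩
  suffices ∃ i < k, v ∈ members k g (codes φ) i (w i) from
    let ⟨i, hi, h⟩ := this; ⟨⟨i, hi⟩, h⟩
  rcases exists_of_lt_leaves hv with rfl | ⟨i, hi, rfl⟩ | ⟨x, hx, rfl⟩ | ⟨j, hj, rfl⟩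
  · exact ⟨0, by omega, by simp [members]⟩
  · exact ⟨i, hi, (group_mem_members hi).2 rfl⟩
  · -- Some group does not contain the variable `x`, because there are at least two groups.
    obtain ⟨i, hi, hne⟩ : ∃ i < k, x / g ≠ i := by
      by_cases h : x / g = 0
      · exact ⟨1, by omega, by omega⟩
      · exact ⟨0, by omega, h⟩
    exact ⟨i, hi, (variable_mem_members hi hx).2 fun h => absurd h hne⟩
  · replace hj : j < φ.length := by simpa [codes] using hj
    obtain ⟨l, hl, hal⟩ := ha φ[j] (List.getElem_mem hj)
    have hlt : (l.1 : ℕ) < k * g := l.1.2.trans_le hg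
    have hg0 : 0 < g := Nat.pos_of_ne_zero fun h => by simp [h] at hlt
    have hi := div_lt_of_lt_mul hlt
    refine ⟨(l.1 : ℕ) / g, hi, (clause_mem_members_codes hi hj).2 ⟨l, hl, rfl, ?_⟩⟩
    rw [hbit _ _ (Nat.mod_lt _ hg0), Nat.div_add_mod']
    simpa [b] using hal

/-- The covering problem that expresses the satisfiability of `φ` if its variables are split into
`k` groups of size `g`. -/
def satInstance (k g : ℕ) (φ : CNFFormula n) : PlanarCoverInstance :=
  starInstance (leaves k g (codes φ)) (objects k g (codes φ)) fun s hs => by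
    obtain ⟨i, -, w, -, rfl⟩ := mem_objects.1 hs
    simp [members]

/-- The input that represents `satInstance k g φ`. -/
def satEncoding (k g : ℕ) (cs : List (List ℕ)) : List ℕ :=
  starEncoding k (leaves k g cs) (objects k g cs)

theorem isEncoding_satEncoding :
    (satInstance k g φ).IsEncoding k (satEncoding k g (codes φ)) := by
  refine isEncoding_starEncoding k _ ?_ ?_ nodup_map_vertexSet_objects <;>
  · intro s hs
    obtain ⟨i, hi, w, -, rfl⟩ := mem_objects.1 hs
    first
    | exact nodup_members hi
    | exact fun v => lt_of_mem_members hi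

theorem card_obj_satInstance_le : (satInstance k g φ).Obj.card ≤ k * 2 ^ g :=
  (List.toFinset_card_le _).trans_eq ((List.length_map _).trans length_objects)

theorem hasCover_satInstance_iff (hk : 2 ≤ k) (hg : n ≤ k * g) :
    (satInstance k g φ).HasCover k ↔ φ.Satisfiable := by
  let A (i : Fin k) (w : Fin (2 ^ g)) :=
    vertexSet (leaves k g (codes φ)) (members k g (codes φ) i w)
  let p (i : Fin k) : Fin (leaves k g (codes φ) + 1) := ⟨i + 1, by grind [leaves]⟩
  have hp (i j w) : p i ∈ A j w ↔ i = j := by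
    rw [mem_vertexSet, group_mem_members i.2, Fin.val_inj]
  have hA (S) : S ∈ ((objects k g (codes φ)).map (vertexSet (leaves k g (codes φ)))).toFinset ↔
      ∃ i w, A i w = S := by
    simp [A, mem_objects, Fin.exists_iff]
  have := exists_card_eq_cover_iff hp hA
  rw [Fintype.card_fin] at this
  rw [satInstance, hasCover_starInstance, this]
  constructor
  · rintro ⟨w, hw⟩
    exact satisfiable_of_covers hg fun v hv => by simpa [A, mem_vertexSet] using hw ⟨v, hv⟩
  · intro hφ
    obtain ⟨w, hw⟩ := exists_covers_of_satisfiable hk hg hφ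
    exact ⟨w, fun v => by simpa [A, mem_vertexSet] using hw v v.2⟩

theorem length_members_le :
    (members k g cs i w).length ≤ k * g + cs.length + 2 := by
  have hv : (variableLeaves k g i w).length ≤ k * g := by
    simpa [variableLeaves] using List.length_filter_le _ (List.range (k * g))
  have hc : (clauseLeaves k g cs i w).length ≤ cs.length := by
    simpa [clauseLeaves] using List.length_filter_le _ (List.range cs.length)
  simp only [members, List.length_cons, List.length_append]
  omega

theorem length_satEncoding_le :
    (satEncoding k g cs).length ≤
      4 + 2 * leaves k g cs + k * 2 ^ g * (k * g + cs.length + 3) := by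
  have hsum : ((objects k g cs).map fun s => (s.length :: s).length).sum ≤
      (objects k g cs).length * (k * g + cs.length + 3) := by
    rw [← List.length_map (fun s : List ℕ => (s.length :: s).length), ← smul_eq_mul]
    refine List.sum_le_card_nsmul _ _ fun l hl => ?_
    obtain ⟨s, hs, rfl⟩ := List.mem_map.1 hl
    obtain ⟨i, -, w, -, rfl⟩ := mem_objects.1 hs
    exact Nat.succ_le_succ length_members_le
  rw [length_objects] at hsum
  simp only [satEncoding, starEncoding, List.length_append, List.length_flatMap, List.length_cons,
    List.length_nil, List.map_const', List.sum_replicate, List.length_range, smul_eq_mul] at hsum ⊢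
  omega

theorem length_add_two_le_length_cnfEncoding : cs.length + 2 ≤ (cnfEncoding n cs).length := by
  simp [cnfEncoding]

theorem length_le_length_cnfEncoding {c : List ℕ} (hc : c ∈ cs) :
    c.length ≤ (cnfEncoding n cs).length :=
  calc c.length ≤ (c.length :: c).length := Nat.le_succ _
    _ ≤ (cs.flatMap fun c => c.length :: c).length := by
      rw [List.length_flatMap]
      exact List.single_le_sum (fun _ _ => Nat.zero_le _) _ (List.mem_map_of_mem hc)
    _ ≤ (cnfEncoding n cs).length := by simp only [cnfEncoding, List.length_cons]; omega

end SatCover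

/-! ### Computations and pieces of code -/

namespace RAM

/-- Started in `σ`, the program `P` comes to `σ'` by a computation of total cost at most `T`. This
is expressed by the halting computations from `σ'`, which extend to computations from `σ`. -/
def ReachesWithin (P : Program) (σ : Config) (T : ℕ) (σ' : Config) : Prop :=
  ∀ t' τ, HaltsIn P σ' t' τ → ∃ t ≤ T + t', HaltsIn P σ t τ

namespace ReachesWithin

variable {P : Program} {σ σ₁ σ₂ σ₃ : Config} {T T' T₁ T₂ : ℕ}

theorem refl (P : Program) (σ : Config) : ReachesWithin P σ 0 σ := fun t' _ h =>
  ⟨t', by omega, h⟩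

theorem mono (h : ReachesWithin P σ₁ T σ₂) (hT : T ≤ T') : ReachesWithin P σ₁ T' σ₂ :=
  fun t' τ h' => (h t' τ h').imp fun _ ht => ⟨ht.1.trans (by omega), ht.2⟩

theorem trans (h₁ : ReachesWithin P σ₁ T₁ σ₂) (h₂ : ReachesWithin P σ₂ T₂ σ₃) :
    ReachesWithin P σ₁ (T₁ + T₂) σ₃ := fun t' τ h => by
  obtain ⟨t₂, ht₂, h⟩ := h₂ t' τ h
  obtain ⟨t₁, ht₁, h⟩ := h₁ t₂ τ h
  exact ⟨t₁, by omega, h⟩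

theorem step {i : Instr} (h : P[σ.pc]? = some i) : ReachesWithin P σ (i.cost σ) (i.exec σ) :=
  fun t' τ h' => ⟨_, le_rfl, HaltsIn.step σ τ i t' h h'⟩

end ReachesWithin

/-- The list `code` is the part of the program `P` that begins at line `l`. -/
def CodeAt (P : Program) (l : ℕ) (code : List Instr) : Prop :=
  ∀ j < code.length, P[l + j]? = code[j]?

theorem codeAt_cons {P : Program} {l : ℕ} {i : Instr} {c : List Instr} :
    CodeAt P l (i :: c) ↔ P[l]? = some i ∧ CodeAt P (l + 1) c := by
  constructor
  · intro h
    refine ⟨h 0 (by simp), fun j hj => ?_⟩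
    have := h (j + 1) (by simpa using hj)
    rwa [add_comm j 1, ← add_assoc, add_comm 1 j, List.getElem?_cons_succ] at this
  · rintro ⟨h₀, h⟩ j hj
    cases j with
    | zero => exact h₀
    | succ j =>
      rw [add_comm j 1, ← add_assoc, h j (by simpa using hj), add_comm 1 j,
        List.getElem?_cons_succ]

theorem codeAt_append {P : Program} {l : ℕ} {c d : List Instr} :
    CodeAt P l (c ++ d) ↔ CodeAt P l c ∧ CodeAt P (l + c.length) d := by
  induction c generalizing l with
  | nil => simp [CodeAt]
  | cons i c ih =>
    rw [List.cons_append, codeAt_cons, codeAt_cons, ih, and_assoc, List.length_cons,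
      add_assoc l 1, add_comm 1]

theorem codeAt_self (P : Program) : CodeAt P 0 P := fun j _ => by rw [zero_add]

end RAM

/-! ### A language of bounded loops, and its compiler -/

namespace LoopLang

open RAM

/-- The variables of the loop language. -/
inductive Reg
  | n | m | k | g | kg | u | o | base | p | len | i | w | e | v | q | lit | a | b | d | flag | sat
  | total | zero | one | two
  deriving DecidableEq

/-- The machine register of a variable. The compiler uses register `0` for constants, and the
registers from `26` on for the counters of loops. -/
def Reg.idx (r : Reg) : ℕ := r.ctorIdx + 1

theorem Reg.idx_injective : Function.Injective Reg.idx := by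
  intro r s h
  cases r <;> cases s <;> first | rfl | simp [Reg.idx, Reg.ctorIdx] at h

theorem Reg.idx_ne_zero (r : Reg) : r.idx ≠ 0 := Nat.succ_ne_zero _

theorem Reg.idx_lt (r : Reg) : r.idx < 26 := by cases r <;> decide

/-- The states of a program of the loop language: the values of its variables and the memory. -/
structure St where
  reg : Reg → ℕ
  mem : ℕ → ℕ

/-- An operation whose result is at most its first operand. Since the loop language is restricted
to these operations, all numbers stay below the running time plus their initial bound. -/
abbrev ShrinkingOp := {o : Op // ∀ x y, o.eval x y ≤ x}

/-- Commands. The command `loop r b` repeats `b` as often as the value of `r` at the beginning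
says. -/
inductive Cmd
  | set (r : Reg) (c : ℕ)
  | inc (r : Reg)
  | op (o : ShrinkingOp) (r x y : Reg)
  | load (r x : Reg)
  | store (r x : Reg)
  | seq (a b : Cmd)
  | loop (r : Reg) (b : Cmd)

infixr:60 ";;" => Cmd.seq

namespace Cmd

/-- The effect of a command. -/
def eval : Cmd → St → St
  | set r c, s => { s with reg := Function.update s.reg r c }
  | inc r, s => { s with reg := Function.update s.reg r (s.reg r + 1) }
  | op o r x y, s => { s with reg := Function.update s.reg r (o.1.eval (s.reg x) (s.reg y)) }
  | load r x, s => { s with reg := Function.update s.reg r (s.mem (s.reg x)) }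
  | store r x, s => { s with mem := Function.update s.mem (s.reg r) (s.reg x) }
  | seq a b, s => b.eval (a.eval s)
  | loop r b, s => b.eval^[s.reg r] s

/-- The number of steps of a command. Setting a variable to `c` counts for more than `c` steps,
so that no number can exceed its initial bound by more than the running time. -/
def time : Cmd → St → ℕ
  | set _ c, _ => c + 1
  | seq a b, s => a.time s + b.time (a.eval s)
  | loop r b, s => 1 + ∑ j ∈ Finset.range (s.reg r), (b.time (b.eval^[j] s) + 1)
  | _, _ => 1

/-- The number of instructions of the compiled command. -/
def size : Cmd → ℕ
  | inc _ => 2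
  | seq a b => a.size + b.size
  | loop _ b => b.size + 6
  | _ => 1

/-- The command as a piece of machine code that begins at line `l`. The counter of a loop is kept
in register `26 + l`. -/
def compile : Cmd → ℕ → Program
  | set r c, _ => [.const r.idx c]
  | inc r, _ => [.const 0 1, .op .add r.idx r.idx 0]
  | op o r x y, _ => [.op o r.idx x.idx y.idx]
  | load r x, _ => [.load r.idx x.idx]
  | store r x, _ => [.store r.idx x.idx]
  | seq a b, l => a.compile l ++ b.compile (l + a.size)
  | loop r b, l => [.op .and (26 + l) r.idx r.idx, .jz (26 + l) (l + (b.size + 6))] ++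
      b.compile (l + 2) ++ [.const 0 1, .op .sub (26 + l) (26 + l) 0, .const 0 0, .jz 0 (l + 1)]

theorem length_compile (c : Cmd) (l : ℕ) : (c.compile l).length = c.size := by
  induction c generalizing l with
  | seq a b iha ihb => rw [compile, size, List.length_append, iha, ihb]
  | loop r b ih => simp [compile, size, ih]
  | _ => rfl

end Cmd

/-- The state `s` of the loop language is represented by the configuration `σ` of the machine. -/
structure Sim (s : St) (σ : Config) : Prop where
  mem : σ.mem = s.mem
  reg : ∀ r : Reg, σ.reg r.idx = s.reg r

/-- All numbers in the state are at most `V`. -/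
structure Bounded (V : ℕ) (s : St) : Prop where
  mem : ∀ x, s.mem x ≤ V
  reg : ∀ r, s.reg r ≤ V

/-- The configurations agree on all counter registers, except on those of the `n` lines that begin
with line `l`. -/
def SameCounters (l n : ℕ) (σ σ' : Config) : Prop :=
  ∀ q, q < l ∨ l + n ≤ q → σ'.reg (26 + q) = σ.reg (26 + q)

variable {s : St} {σ σ' : Config} {V W : ℕ}

theorem Bounded.mono (h : Bounded V s) (hV : V ≤ W) : Bounded W s :=
  ⟨fun x => (h.mem x).trans hV, fun r => (h.reg r).trans hV⟩

theorem Bounded.update_reg (h : Bounded V s) (r : Reg) {x : ℕ} (hx : x ≤ V) :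
    Bounded V { s with reg := Function.update s.reg r x } :=
  ⟨h.mem, Function.forall_update_iff _ (fun _ y => y ≤ V) |>.2 ⟨hx, fun r _ => h.reg r⟩⟩

theorem Bounded.iterate {b : Cmd} (hb : ∀ {V s}, Bounded V s → Bounded (V + b.time s) (b.eval s))
    (h : Bounded V s) (j : ℕ) :
    Bounded (V + ∑ i ∈ Finset.range j, (b.time (b.eval^[i] s) + 1)) (b.eval^[j] s) := by
  induction j with
  | zero => exact h
  | succ j ih =>
    rw [Finset.sum_range_succ, Function.iterate_succ_apply']
    exact (hb ih).mono (by omega)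

theorem Bounded.eval (c : Cmd) (h : Bounded V s) : Bounded (V + c.time s) (c.eval s) := by
  induction c generalizing s V with
  | set r x => exact (h.mono (Nat.le_add_right _ _)).update_reg r (by simp only [Cmd.time]; omega)
  | inc r =>
    exact (h.mono (Nat.le_add_right _ _)).update_reg r (Nat.add_le_add_right (h.reg r) 1)
  | op o r x y =>
    exact (h.mono (Nat.le_add_right _ _)).update_reg r
      ((o.2 _ _).trans ((h.reg x).trans (Nat.le_add_right _ _)))
  | load r x =>
    exact (h.mono (Nat.le_add_right _ _)).update_reg r
      ((h.mem _).trans (Nat.le_add_right _ _))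
  | store r x =>
    have hmem : ∀ y, Function.update s.mem (s.reg r) (s.reg x) y ≤ V :=
      Function.forall_update_iff _ (fun _ y => y ≤ V) |>.2 ⟨h.reg x, fun y _ => h.mem y⟩
    exact Bounded.mono ⟨hmem, h.reg⟩ (Nat.le_add_right _ _)
  | seq a b iha ihb => exact (ihb (iha h)).mono (by simp only [Cmd.time]; omega)
  | loop r b ih => exact (h.iterate ih _).mono (by simp only [Cmd.time]; omega)

theorem Sim.update_reg (h : Sim s σ) (r : Reg) (x pc : ℕ) :
    Sim { s with reg := Function.update s.reg r x }
      { σ with pc := pc, reg := Function.update σ.reg r.idx x } where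
  mem := h.mem
  reg r' := by
    rcases eq_or_ne r' r with rfl | hr
    · simp
    · simp [hr, Reg.idx_injective.ne hr, h.reg]

theorem Sim.update_of_ne (h : Sim s σ) {q : ℕ} (hq : ∀ r : Reg, r.idx ≠ q) (x pc : ℕ) :
    Sim s { σ with pc := pc, reg := Function.update σ.reg q x } where
  mem := h.mem
  reg r := by simp [hq r, h.reg]

theorem Reg.idx_ne_add (r : Reg) (l : ℕ) : r.idx ≠ 26 + l := by
  have := r.idx_lt
  omega

theorem SameCounters.update (l n pc x : ℕ) {q : ℕ} (hq : q < 26) :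
    SameCounters l n σ { σ with pc := pc, reg := Function.update σ.reg q x } := fun q' _ => by
  simp [show 26 + q' ≠ q by omega]

theorem SameCounters.trans {σ'' : Config} {l n : ℕ} (h : SameCounters l n σ σ')
    (h' : SameCounters l n σ' σ'') : SameCounters l n σ σ'' := fun q hq =>
  (h' q hq).trans (h q hq)

theorem SameCounters.mono {l n l' n' : ℕ} (h : SameCounters l n σ σ') (hl : l' ≤ l)
    (hn : l + n ≤ l' + n') : SameCounters l' n' σ σ' := fun q hq => h q (by omega)

/-- The compiled code of a command does what the command does. No number exceeds `W`, so that a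
step of the command takes at most five machine instructions of cost `7 + 3 * W.size` in total. -/
def Correct (b : Cmd) : Prop :=
  ∀ ⦃P : Program⦄ ⦃s : St⦄ ⦃σ : Config⦄ ⦃V W : ℕ⦄, CodeAt P σ.pc (b.compile σ.pc) → Sim s σ →
    Bounded V s → V + b.time s ≤ W →
    ∃ σ', ReachesWithin P σ ((7 + 3 * W.size) * b.time s) σ' ∧ σ'.pc = σ.pc + b.size ∧
      Sim (b.eval s) σ' ∧ SameCounters σ.pc b.size σ σ'

theorem correct_set (r : Reg) (c : ℕ) : Correct (.set r c) := by
  intro P s σ V W hP hs _ hW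
  have hc : c.size ≤ W.size := Nat.size_le_size (by simp only [Cmd.time] at hW; omega)
  refine ⟨_, (ReachesWithin.step (codeAt_cons.1 hP).1).mono ?_, rfl, hs.update_reg r _ _,
    .update _ _ _ _ r.idx_lt⟩
  simp only [Instr.cost, Cmd.time]
  nlinarith

theorem correct_op (o : ShrinkingOp) (r x y : Reg) : Correct (.op o r x y) := by
  intro P s σ V W hP hs hV hW
  have hx : (s.reg x).size ≤ W.size := Nat.size_le_size ((hV.reg x).trans (by omega))
  have hy : (s.reg y).size ≤ W.size := Nat.size_le_size ((hV.reg y).trans (by omega))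
  have ho := (Nat.size_le_size (o.2 (s.reg x) (s.reg y))).trans hx
  refine ⟨_, (ReachesWithin.step (codeAt_cons.1 hP).1).mono ?_, rfl, ?_,
    .update _ _ _ _ r.idx_lt⟩
  · simp only [Instr.cost, Cmd.time, hs.reg]
    omega
  · rw [Instr.exec, hs.reg, hs.reg]
    exact hs.update_reg r _ _

theorem correct_inc (r : Reg) : Correct (.inc r) := by
  intro P s σ V W hP hs hV hW
  have hr : (s.reg r).size ≤ W.size := Nat.size_le_size ((hV.reg r).trans (by omega))
  have hr' : (s.reg r + 1).size ≤ W.size :=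
    Nat.size_le_size ((Nat.add_le_add_right (hV.reg r) 1).trans hW)
  obtain ⟨h₁, h₂⟩ := codeAt_cons.1 hP
  have hs₁ := hs.update_of_ne (fun r => r.idx_ne_zero) 1 (σ.pc + 1)
  refine ⟨_, ((ReachesWithin.step h₁).trans (.step (codeAt_cons.1 h₂).1)).mono ?_, rfl, ?_,
    (SameCounters.update _ _ _ _ (by norm_num)).trans (.update _ _ _ _ r.idx_lt)⟩
  · simp only [Instr.cost, Instr.exec, Op.eval, Cmd.time, hs₁.reg, Function.update_self,
      Nat.size_one]
    omega
  · simp only [Instr.exec, Op.eval, hs₁.reg, Function.update_self]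
    exact hs₁.update_reg r _ _

theorem correct_load (r x : Reg) : Correct (.load r x) := by
  intro P s σ V W hP hs hV hW
  have hx : (s.reg x).size ≤ W.size := Nat.size_le_size ((hV.reg x).trans (by omega))
  have hm : (s.mem (s.reg x)).size ≤ W.size := Nat.size_le_size ((hV.mem _).trans (by omega))
  refine ⟨_, (ReachesWithin.step (codeAt_cons.1 hP).1).mono ?_, rfl, ?_,
    .update _ _ _ _ r.idx_lt⟩
  · simp only [Instr.cost, Cmd.time, hs.reg, hs.mem]
    omega
  · rw [Instr.exec, hs.reg, congrFun hs.mem]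
    exact hs.update_reg r _ _

theorem correct_store (r x : Reg) : Correct (.store r x) := by
  intro P s σ V W hP hs hV hW
  have hr : (s.reg r).size ≤ W.size := Nat.size_le_size ((hV.reg r).trans (by omega))
  have hx : (s.reg x).size ≤ W.size := Nat.size_le_size ((hV.reg x).trans (by omega))
  refine ⟨_, (ReachesWithin.step (codeAt_cons.1 hP).1).mono ?_, rfl, ⟨?_, hs.reg⟩,
    fun q _ => rfl⟩
  · simp only [Instr.cost, Cmd.time, hs.reg]
    omega
  · simp only [Instr.exec, Cmd.eval, hs.reg, hs.mem]

theorem Correct.seq {a b : Cmd} (ha : Correct a) (hb : Correct b) : Correct (.seq a b) := by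
  intro P s σ V W hP hs hV hW
  simp only [Cmd.time] at hW
  rw [Cmd.compile, codeAt_append, Cmd.length_compile] at hP
  obtain ⟨σ₁, h₁, hpc₁, hs₁, hq₁⟩ := ha hP.1 hs hV (W := W) (by omega)
  rw [← hpc₁] at hP
  obtain ⟨σ₂, h₂, hpc₂, hs₂, hq₂⟩ := hb hP.2 hs₁ (hV.eval a) (W := W) (by omega)
  refine ⟨σ₂, (h₁.trans h₂).mono (by rw [Cmd.time, mul_add]), ?_, hs₂, ?_⟩
  · rw [hpc₂, hpc₁, Cmd.size, add_assoc]
  · exact (hq₁.mono le_rfl (by simp only [Cmd.size]; omega)).trans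
      (hq₂.mono (by omega) (by simp only [Cmd.size]; omega))

theorem reachesWithin_loopEnd {P : Program} {σ : Config} {c l W : ℕ} (hc : c ≠ 0)
    (hP : CodeAt P σ.pc [.const 0 1, .op .sub c c 0, .const 0 0, .jz 0 l])
    (hW : σ.reg c ≤ W) :
    ∃ σ', ReachesWithin P σ (6 + 2 * W.size) σ' ∧ σ'.pc = l ∧ σ'.mem = σ.mem ∧
      σ'.reg c = σ.reg c - 1 ∧ ∀ q ≠ 0, q ≠ c → σ'.reg q = σ.reg q := by
  simp only [codeAt_cons] at hP
  obtain ⟨h₁, h₂, h₃, h₄, -⟩ := hP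
  let σ₁ := Instr.exec (.const 0 1) σ
  let σ₂ := Instr.exec (.op .sub c c 0) σ₁
  let σ₃ := Instr.exec (.const 0 0) σ₂
  refine ⟨_, ((((ReachesWithin.step (σ := σ) h₁).trans (.step (σ := σ₁) h₂)).trans
    (.step (σ := σ₂) h₃)).trans (.step (σ := σ₃) h₄)).mono ?_, ?_, rfl, ?_, ?_⟩
  · have h₀ : (σ.reg c).size ≤ W.size := Nat.size_le_size hW
    have h₁ : (σ.reg c - 1).size ≤ W.size := Nat.size_le_size ((Nat.sub_le _ _).trans hW)
    simp only [σ₁, σ₂, σ₃, Instr.cost, Instr.exec, Op.eval, Function.update_self, ne_eq, hc,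
      not_false_eq_true, Function.update_of_ne, Nat.size_one, Nat.size_zero]
    omega
  · simp [σ₃, Instr.exec]
  · simp [σ₁, σ₂, σ₃, Instr.exec, Op.eval, hc]
  · intro q hq hqc
    simp [σ₁, σ₂, σ₃, Instr.exec, hq, hqc]

theorem Correct.loopHead {b : Cmd} (hb : Correct b) {P : Program} {l W : ℕ}
    (hP : P[l + 1]? = some (.jz (26 + l) (l + (b.size + 6))))
    (hbody : CodeAt P (l + 2) (b.compile (l + 2)))
    (hend : CodeAt P (l + 2 + b.size)
      [.const 0 1, .op .sub (26 + l) (26 + l) 0, .const 0 0, .jz 0 (l + 1)])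
    (j : ℕ) {s : St} {σ : Config} {V : ℕ} (hpc : σ.pc = l + 1) (hj : σ.reg (26 + l) = j)
    (hjW : j ≤ W) (hs : Sim s σ) (hV : Bounded V s)
    (hW : V + ∑ i ∈ Finset.range j, (b.time (b.eval^[i] s) + 1) ≤ W) :
    ∃ σ', ReachesWithin P σ ((7 + 3 * W.size) *
        ∑ i ∈ Finset.range j, (b.time (b.eval^[i] s) + 1) + 1) σ' ∧
      σ'.pc = l + (b.size + 6) ∧ Sim (b.eval^[j] s) σ' ∧ SameCounters l (b.size + 6) σ σ' := by
  have hjz := ReachesWithin.step (hpc ▸ hP)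
  induction j generalizing s σ V with
  | zero =>
    exact ⟨_, hjz.mono (by simp [Instr.cost, hj]), by simp [Instr.exec, hj], ⟨hs.mem, hs.reg⟩,
      fun q _ => rfl⟩
  | succ j ih =>
    simp only [Finset.sum_range_succ', Function.iterate_succ_apply,
      Function.iterate_zero_apply] at hW ⊢
    have hpc₁ : (Instr.exec (.jz (26 + l) (l + (b.size + 6))) σ).pc = l + 2 := by
      simp [Instr.exec, hj, hpc]
    obtain ⟨σ₂, h₂, hpc₂, hs₂, hq₂⟩ :=
      hb (hpc₁ ▸ hbody) (σ := Instr.exec (.jz (26 + l) (l + (b.size + 6))) σ)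
        ⟨hs.mem, hs.reg⟩ hV (W := W) (by omega)
    rw [hpc₁] at hpc₂ hq₂
    have hc₂ : σ₂.reg (26 + l) = j + 1 := (hq₂ l (by omega)).trans hj
    obtain ⟨σ₃, h₃, hpc₃, hm₃, hc₃, hq₃⟩ :=
      reachesWithin_loopEnd (by omega) (hpc₂ ▸ hend) (hc₂.trans_le hjW)
    have hs₃ : Sim (b.eval s) σ₃ := ⟨hm₃.trans hs₂.mem, fun r =>
      (hq₃ _ r.idx_ne_zero (r.idx_ne_add l)).trans (hs₂.reg r)⟩
    obtain ⟨σ₄, h₄, hpc₄, hs₄, hq₄⟩ := ih hpc₃ (by rw [hc₃, hc₂, Nat.add_sub_cancel])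
      (by omega) hs₃ (hV.eval b) (by omega) (ReachesWithin.step (hpc₃ ▸ hP))
    refine ⟨σ₄, (((hjz.trans h₂).trans h₃).trans h₄).mono ?_, hpc₄, hs₄, fun q hq => ?_⟩
    · have : (j + 1).size ≤ W.size := Nat.size_le_size hjW
      simp only [Instr.cost, hj, mul_add]
      omega
    · rw [hq₄ q hq, hq₃ _ (by omega) (by omega), hq₂ q (by omega)]
      rfl

theorem Correct.loop {b : Cmd} (hb : Correct b) (r : Reg) : Correct (.loop r b) := by
  intro P s σ V W hP hs hV hW
  rw [Cmd.compile, codeAt_append, codeAt_append, codeAt_cons, codeAt_cons] at hP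
  obtain ⟨⟨⟨hand, hjz, -⟩, hbody⟩, hend⟩ := hP
  rw [List.length_append, Cmd.length_compile, ← add_assoc] at hend
  have hrW : s.reg r ≤ W := (hV.reg r).trans (by omega)
  simp only [Cmd.time] at hW
  have hpc₁ : (Instr.exec (.op .and (26 + σ.pc) r.idx r.idx) σ).pc = σ.pc + 1 := rfl
  obtain ⟨σ', h, hpc', hs', hq'⟩ := hb.loopHead hjz hbody hend (s.reg r)
    hpc₁ (by simp [Instr.exec, Op.eval, hs.reg]) hrW
    (hs.update_of_ne (fun r => r.idx_ne_add _) _ _) hV (by omega)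
  refine ⟨σ', ((ReachesWithin.step hand).trans h).mono ?_, hpc', hs', fun q hq => ?_⟩
  · have := Nat.size_le_size hrW
    simp only [Instr.cost, Op.eval, Nat.and_self, hs.reg, Cmd.time, mul_add]
    omega
  · rw [Cmd.size] at hq
    rw [hq' q hq]
    simp [Instr.exec, show q ≠ σ.pc by omega]

theorem correct (c : Cmd) : Correct c := by
  induction c with
  | set r x => exact correct_set r x
  | inc r => exact correct_inc r
  | op o r x y => exact correct_op o r x y
  | load r x => exact correct_load r x
  | store r x => exact correct_store r x
  | seq a b iha ihb => exact iha.seq ihb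
  | loop r b ih => exact ih.loop r

end LoopLang

/-! ### Reasoning about loop programs -/

namespace LoopLang

namespace Cmd

/-- The command `c` contains no assignment to the variable `x`. -/
def keeps (x : Reg) : Cmd → Bool
  | set r _ | inc r | op _ r _ _ | load r _ => r ≠ x
  | store _ _ => true
  | seq a b => a.keeps x && b.keeps x
  | loop _ b => b.keeps x

/-- The command `c` contains no store. -/
def storeFree : Cmd → Bool
  | store _ _ => false
  | seq a b => a.storeFree && b.storeFree
  | loop _ b => b.storeFree
  | _ => true

theorem eval_loop_of_invariant {b : Cmd} {α : Type*} (f : St → α) (h : ∀ s, f (b.eval s) = f s)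
    (r : Reg) (s : St) : f ((loop r b).eval s) = f s :=
  (Function.Semiconj.iterate_right (f := f) (gb := id) h _ s).trans
    (by rw [Function.iterate_id, id])

theorem reg_eval_of_keeps {c : Cmd} {x : Reg} (h : c.keeps x) (s : St) :
    (c.eval s).reg x = s.reg x := by
  induction c generalizing s with
  | seq a b iha ihb =>
    rw [keeps, Bool.and_eq_true] at h
    rw [eval, ihb h.2, iha h.1]
  | loop r b ih => exact eval_loop_of_invariant (fun s => s.reg x) (ih h) r s
  | store r y => rfl
  | _ => exact Function.update_of_ne (Ne.symm (by simpa [keeps] using h)) _ _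

theorem mem_eval_of_storeFree {c : Cmd} (h : c.storeFree) (s : St) :
    (c.eval s).mem = s.mem := by
  induction c generalizing s with
  | seq a b iha ihb =>
    rw [storeFree, Bool.and_eq_true] at h
    rw [eval, ihb h.2, iha h.1]
  | loop r b ih => exact eval_loop_of_invariant St.mem (ih h) r s
  | store r y => simp [storeFree] at h
  | _ => rfl

end Cmd

/-- The states `s` and `s'` differ only where the command `c` can make a difference. -/
structure Frame (c : Cmd) (s s' : St) : Prop where
  reg : ∀ x, c.keeps x → s'.reg x = s.reg x
  mem : c.storeFree → s'.mem = s.mem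

theorem frame_eval (c : Cmd) (s : St) : Frame c s (c.eval s) :=
  ⟨fun _ h => Cmd.reg_eval_of_keeps h s, fun h => Cmd.mem_eval_of_storeFree h s⟩

theorem frame_iterate (c : Cmd) (s : St) (j : ℕ) : Frame c s (c.eval^[j] s) := by
  induction j with
  | zero => exact ⟨fun _ _ => rfl, fun _ => rfl⟩
  | succ j ih =>
    rw [Function.iterate_succ_apply']
    exact ⟨fun x h => ((frame_eval c _).reg x h).trans (ih.reg x h),
      fun h => ((frame_eval c _).mem h).trans (ih.mem h)⟩

/-- Started in `s`, the command `c` takes at most `T` steps and establishes `Q`. -/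
def Runs (c : Cmd) (s : St) (T : ℕ) (Q : St → Prop) : Prop :=
  c.time s ≤ T ∧ Q (c.eval s)

namespace Runs

variable {a b c : Cmd} {r : Reg} {s : St} {T T₁ T₂ D N : ℕ} {Q R : St → Prop}

theorem mono (h : Runs c s T Q) (hQ : ∀ s', Frame c s s' → Q s' → R s') : Runs c s T R :=
  ⟨h.1, hQ _ (frame_eval c s) h.2⟩

theorem le_time (h : Runs c s T₁ Q) (hT : T₁ ≤ T₂) : Runs c s T₂ Q :=
  ⟨h.1.trans hT, h.2⟩

theorem seq (ha : Runs a s T₁ Q)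
    (hb : ∀ s', Frame a s s' → Q s' → Runs b s' (T - T₁) R) (hT : T₁ ≤ T := by omega) :
    Runs (a ;; b) s T R := by
  have h := hb _ (frame_eval a s) ha.2
  refine ⟨?_, h.2⟩
  have := ha.1
  have := h.1
  simp only [Cmd.time]
  omega

theorem loop (I : ℕ → St → Prop) (hN : s.reg r = N) (h₀ : I 0 s)
    (hb : ∀ j < N, ∀ s', Frame b s s' → I j s' → Runs b s' D (I (j + 1))) :
    Runs (.loop r b) s (N * (D + 1) + 1) (I N) := by
  have hI : ∀ j ≤ N, I j (b.eval^[j] s) := fun j => by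
    induction j with
    | zero => exact fun _ => h₀
    | succ j ih =>
      intro hj
      rw [Function.iterate_succ_apply']
      exact (hb j hj _ (frame_iterate b s j) (ih (by omega))).2
  refine ⟨?_, by rw [Cmd.eval, hN]; exact hI N le_rfl⟩
  have hsum := Finset.sum_le_card_nsmul (Finset.range N) (fun j => b.time (b.eval^[j] s) + 1)
    (D + 1) fun j hj => Nat.succ_le_succ
      (hb j (Finset.mem_range.1 hj) _ (frame_iterate b s j) (hI j (Finset.mem_range.1 hj).le)).1
  rw [Finset.card_range, smul_eq_mul] at hsum
  rw [Cmd.time, hN, add_comm]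
  exact Nat.add_le_add_right hsum 1

theorem loop_ite {p : Prop} [Decidable p] (hr : s.reg r = if p then 1 else 0)
    (ht : p → Runs b s D Q) (he : ¬ p → Q s) : Runs (.loop r b) s (D + 2) Q := by
  by_cases hp : p
  · rw [if_pos hp] at hr
    have h := ht hp
    refine ⟨?_, by simpa only [Cmd.eval, hr, Function.iterate_one] using h.2⟩
    have := h.1
    simp only [Cmd.time, hr, Finset.sum_range_one, Function.iterate_zero_apply]
    omega
  · rw [if_neg hp] at hr
    exact ⟨by simp [Cmd.time, hr],
      by simpa only [Cmd.eval, hr, Function.iterate_zero_apply] using he hp⟩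

end Runs

/-! ### Arithmetic in the loop language -/

open Cmd

/-- Subtraction is an operation of the loop language. -/
def subOp : ShrinkingOp := ⟨.sub, Nat.sub_le⟩

/-- Division is an operation of the loop language. -/
def divOp : ShrinkingOp := ⟨.div, Nat.div_le_self⟩

/-- The remainder is an operation of the loop language. -/
def modOp : ShrinkingOp := ⟨.mod, Nat.mod_le⟩

/-- The right shift is an operation of the loop language. -/
def shrOp : ShrinkingOp := ⟨.shr, fun x y => by
  rw [RAM.Op.eval, Nat.shiftRight_eq_div_pow]
  exact Nat.div_le_self _ _⟩

/-- The assignment `r := x`. -/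
def mov (r x : Reg) : Cmd := op ⟨.and, fun _ _ => Nat.and_le_left⟩ r x x

/-- The assignment `r := r + x`. -/
def addTo (r x : Reg) : Cmd := loop x (inc r)

/-- The assignment `r := r + x * y`. -/
def addMulTo (r x y : Reg) : Cmd := loop x (addTo r y)

/-- The assignment `r := 2 ^ x`. -/
def powTwo (r x : Reg) : Cmd := set r 1 ;; loop x (addTo r r)

theorem eval_mov (r x : Reg) (s : St) :
    (mov r x).eval s = { s with reg := Function.update s.reg r (s.reg x) } := by
  simp [mov, Cmd.eval, RAM.Op.eval]

variable {r x y : Reg} {s : St} {a n m : ℕ}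

theorem runs_addTo (hr : s.reg r = a) (hx : s.reg x = n) :
    Runs (addTo r x) s (2 * n + 1) fun s' => s'.reg r = a + n :=
  (Runs.loop (D := 1) (fun j s' => s'.reg r = a + j) hx hr fun j _ s' _ h =>
    ⟨le_rfl, by simp [Cmd.eval, h, add_assoc]⟩).le_time (by omega)

theorem runs_addMulTo (hry : r ≠ y) (hr : s.reg r = a) (hx : s.reg x = n) (hy : s.reg y = m) :
    Runs (addMulTo r x y) s (n * (2 * m + 2) + 1) fun s' => s'.reg r = a + n * m :=
  Runs.loop (D := 2 * m + 1) (fun j s' => s'.reg r = a + j * m) hx (by simpa using hr)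
    fun j _ s' f h => (runs_addTo h ((f.reg y (by simpa [addTo, keeps] using hry)).trans hy)).mono
      fun s'' _ h' => by rw [h', add_mul, one_mul, add_assoc]

theorem runs_powTwo (hrx : r ≠ x) (hx : s.reg x = n) :
    Runs (powTwo r x) s (n * (2 * 2 ^ n + 2) + 3) fun s' => s'.reg r = 2 ^ n := by
  have hset : Runs (set r 1) s 2 fun s' => s'.reg r = 2 ^ 0 := ⟨le_rfl, by simp [Cmd.eval]⟩
  refine hset.seq fun s₁ f₁ h₁ => (Runs.loop (D := 2 * 2 ^ n + 1) (fun j s' => s'.reg r = 2 ^ j)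
    ((f₁.reg x (by simpa [keeps] using hrx)).trans hx) h₁ fun j hj s' _ h => ?_).le_time le_rfl
  have := Nat.pow_le_pow_right two_pos hj.le
  exact ((runs_addTo h h).le_time (by omega)).mono fun s'' _ h' => by rw [h', pow_succ, mul_two]

end LoopLang

/-! ### The tape -/

namespace LoopLang

open Cmd

variable {x out rest : List ℕ} {s s' : St} {c b : Cmd} {r : Reg} {y : ℕ}

/-- The memory holds the input `x`, followed by the list `out` of the numbers written so far, and
the variable `o` points to the cell behind them. -/
structure Writing (x out : List ℕ) (s : St) : Prop where
  mem : ∀ a, s.mem a = (x ++ out).getD a 0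
  o : s.reg .o = (x ++ out).length

/-- The part `rest` of the input `x` begins at the cell to which the variable `p` points. -/
def Reading (x rest : List ℕ) (s : St) : Prop :=
  x.drop (s.reg .p) = rest

theorem Writing.frame (h : Writing x out s) (hf : Frame c s s') (ho : c.keeps .o)
    (hc : c.storeFree) : Writing x out s' :=
  ⟨fun a => (congrFun (hf.mem hc) a).trans (h.mem a), (hf.reg _ ho).trans h.o⟩

theorem Reading.frame (h : Reading x rest s) (hf : Frame c s s') (hp : c.keeps .p) :
    Reading x rest s' := by
  rw [Reading, hf.reg _ hp, h]

theorem Reading.mem_eq (hp : Reading x (y :: rest) s) (hm : ∀ a, s.mem a = (x ++ out).getD a 0) :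
    s.mem (s.reg .p) = y := by
  have hy : x[s.reg .p]? = some y := by rw [← List.head?_drop, hp, List.head?_cons]
  rw [hm, List.getD_eq_getElem?_getD,
    List.getElem?_append_left (List.getElem?_eq_some_iff.1 hy).1, hy, Option.getD_some]

theorem Writing.update_mem {z : ℕ} {ys : List ℕ} (h : Writing x (out ++ z :: ys) s) (y : ℕ) :
    Writing x (out ++ y :: ys)
      { s with mem := Function.update s.mem (x ++ out).length y } := by
  refine ⟨fun a => ?_, by simpa using h.o⟩
  have hset : x ++ (out ++ y :: ys) = (x ++ (out ++ z :: ys)).set (x ++ out).length y := by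
    simp
  rw [hset, List.getD_eq_getElem?_getD, List.getElem?_set]
  rcases eq_or_ne a (x ++ out).length with rfl | ha
  · simp
  · simp only [Function.update_of_ne ha, h.mem, ha.symm, if_false, List.getD_eq_getElem?_getD]

/-- Reads the next number of the input into the variable `r`. -/
def read (r : Reg) : Cmd := load r .p ;; inc .p

/-- Appends the value of the variable `r` to the output. -/
def emit (r : Reg) : Cmd := store .o r ;; inc .o

theorem runs_read (hr : r ≠ .p) (hm : ∀ a, s.mem a = (x ++ out).getD a 0)
    (hp : Reading x (y :: rest) s) :
    Runs (read r) s 2 fun s' => s'.reg r = y ∧ Reading x rest s' := by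
  refine ⟨le_rfl, ?_, ?_⟩
  · simp [read, Cmd.eval, hr, hp.mem_eq hm]
  · have hrest : x.drop (s.reg .p + 1) = rest := by rw [← List.tail_drop, hp, List.tail_cons]
    simpa [read, Cmd.eval, Reading, hr.symm] using hrest

theorem runs_emit (h : Writing x out s) (hy : s.reg r = y) :
    Runs (emit r) s 2 (Writing x (out ++ [y])) := by
  refine ⟨le_rfl, fun a => ?_, by simp [emit, Cmd.eval, h.o, add_assoc]⟩
  simp only [emit, Cmd.eval, h.o, hy]
  rcases lt_trichotomy a (x ++ out).length with ha | rfl | ha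
  · rw [Function.update_of_ne ha.ne, h.mem, ← List.append_assoc, List.getD_append _ _ _ _ ha]
  · simp
  · rw [Function.update_of_ne ha.ne', h.mem, List.getD_eq_default _ _ ha.le,
      List.getD_eq_default]
    simp only [List.length_append, List.length_singleton] at ha ⊢
    omega

theorem runs_loop_emits {D N : ℕ} (J : ℕ → St → Prop) (f : ℕ → List ℕ) (hN : s.reg r = N)
    (hs : Writing x out s) (hJ : J 0 s)
    (hb : ∀ j < N, ∀ s' out', Frame b s s' → Writing x out' s' → J j s' →
      Runs b s' D fun s'' => Writing x (out' ++ f j) s'' ∧ J (j + 1) s'') :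
    Runs (.loop r b) s (N * (D + 1) + 1)
      fun s' => Writing x (out ++ (List.range N).flatMap f) s' ∧ J N s' :=
  Runs.loop (fun j s' => Writing x (out ++ (List.range j).flatMap f) s' ∧ J j s') hN
    ⟨by simpa using hs, hJ⟩ fun j hj s' hf h => (hb j hj s' _ hf h.1 h.2).mono fun s'' _ h => by
      simpa [List.range_succ] using h

end LoopLang

/-! ### Writing the sets -/

theorem map_filter_eq_flatMap {α β : Type*} (p : α → Bool) (f : α → β) (l : List α) :
    (l.filter p).map f = l.flatMap fun a => if p a then [f a] else [] := by
  induction l with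
  | nil => rfl
  | cons a l ih => cases h : p a <;> simp [h, ih]

namespace LoopLang

open Cmd SatCover

variable {x out : List ℕ} {s s' : St} {c : Cmd} {r : Reg} {k g i w t y : ℕ}
  {cs : List (List ℕ)}

/-- The variables that hold the parameters of the reduction. -/
def parameters : List Reg := [.zero, .one, .two, .k, .g, .kg, .m, .e]

/-- The parameters of the reduction for the formula with the clauses `cs`. -/
structure Params (k g : ℕ) (cs : List (List ℕ)) (s : St) : Prop where
  reg_zero : s.reg .zero = 0
  reg_one : s.reg .one = 1
  reg_two : s.reg .two = 2
  reg_k : s.reg .k = k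
  reg_g : s.reg .g = g
  reg_kg : s.reg .kg = k * g
  reg_m : s.reg .m = cs.length
  reg_e : s.reg .e = 2 ^ g

theorem Params.frame (h : Params k g cs s) (hf : Frame c s s')
    (hc : ∀ r ∈ parameters, c.keeps r) : Params k g cs s' where
  reg_zero := (hf.reg _ (hc _ (by decide))).trans h.reg_zero
  reg_one := (hf.reg _ (hc _ (by decide))).trans h.reg_one
  reg_two := (hf.reg _ (hc _ (by decide))).trans h.reg_two
  reg_k := (hf.reg _ (hc _ (by decide))).trans h.reg_k
  reg_g := (hf.reg _ (hc _ (by decide))).trans h.reg_g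
  reg_kg := (hf.reg _ (hc _ (by decide))).trans h.reg_kg
  reg_m := (hf.reg _ (hc _ (by decide))).trans h.reg_m
  reg_e := (hf.reg _ (hc _ (by decide))).trans h.reg_e

/-- Sets the variable `flag` to `1` if the partial assignment `w` of group `i` makes the literal
`lit` true, and to `0` otherwise. -/
def testLiteral : Cmd :=
  op divOp .a .lit .two ;; op divOp .b .a .g ;; op modOp .a .a .g ;; op shrOp .a .w .a ;;
  op modOp .a .a .two ;; op modOp .d .lit .two ;;
  op subOp .flag .b .i ;; op subOp .flag .one .flag ;; op subOp .b .i .b ;;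
  op subOp .flag .flag .b ;; op subOp .b .a .d ;; op subOp .flag .flag .b ;;
  op subOp .b .d .a ;; op subOp .flag .flag .b

theorem runs_testLiteral (hs : Params k g cs s) (hi : s.reg .i = i) (hw : s.reg .w = w)
    (ht : s.reg .lit = t) :
    Runs testLiteral s 14 fun s' => s'.reg .flag = if agrees g i w t then 1 else 0 := by
  refine ⟨le_rfl, ?_⟩
  have hflag : (testLiteral.eval s).reg .flag = 1 - (t / 2 / g - i) - (i - t / 2 / g) -
      (w / 2 ^ (t / 2 % g) % 2 - t % 2) - (t % 2 - w / 2 ^ (t / 2 % g) % 2) := by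
    simp [testLiteral, Cmd.eval, divOp, modOp, shrOp, subOp, RAM.Op.eval, hi, hw, ht, hs.reg_g,
      hs.reg_one, hs.reg_two, Nat.shiftRight_eq_div_pow]
  simp only [hflag, agrees, Nat.toNat_testBit, decide_eq_true_eq]
  split_ifs with h <;> omega

theorem runs_loop_emit {p : Prop} [Decidable p] (hr : s.reg r = if p then 1 else 0)
    (hs : Writing x out s) (hy : s.reg .v = y) :
    Runs (.loop r (emit .v)) s 4 (Writing x (out ++ if p then [y] else [])) :=
  Runs.loop_ite hr (fun hp => by simpa only [if_pos hp] using runs_emit hs hy)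
    fun hp => by simpa only [if_neg hp, List.append_nil] using hs

/-- Writes the leaf of the next variable, unless the partial assignment makes it false. -/
def emitVariable : Cmd :=
  inc .v ;; testLiteral ;; op subOp .flag .one .flag ;; .loop .flag (emit .v) ;; inc .lit ;;
    inc .lit

/-- Writes the leaves of the variables that are not made false by the partial assignment. -/
def emitVariables : Cmd := mov .v .k ;; set .lit 0 ;; .loop .kg emitVariable

theorem runs_emitVariable {z : ℕ} (hP : Params k g cs s) (hs : Writing x out s)
    (hi : s.reg .i = i) (hw : s.reg .w = w) (hv : s.reg .v = k + z) (hz : s.reg .lit = 2 * z) :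
    Runs emitVariable s 22 fun s' =>
      Writing x (out ++ if !agrees g i w (2 * z) then [k + 1 + z] else []) s' ∧
        s'.reg .v = k + (z + 1) ∧ s'.reg .lit = 2 * (z + 1) := by
  have hinc : Runs (inc .v) s 1 fun s' => s'.reg .v = k + 1 + z :=
    ⟨le_rfl, by simp only [Cmd.eval, hv, Function.update_self]; omega⟩
  refine hinc.seq fun s₁ f₁ hv₁ => ?_
  have hP₁ := hP.frame f₁ (by decide)
  refine (runs_testLiteral hP₁ ((f₁.reg _ rfl).trans hi) ((f₁.reg _ rfl).trans hw)
    ((f₁.reg _ rfl).trans hz)).seq fun s₂ f₂ hflag => ?_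
  have hneg : Runs (op subOp .flag .one .flag) s₂ 1 fun s' =>
      s'.reg .flag = if !agrees g i w (2 * z) then 1 else 0 := by
    refine ⟨le_rfl, ?_⟩
    cases h : agrees g i w (2 * z) <;>
      simp [Cmd.eval, subOp, RAM.Op.eval, (hP₁.frame f₂ (by decide)).reg_one, hflag, h]
  refine hneg.seq fun s₃ f₃ hflag₃ => ?_
  have hs₃ := ((hs.frame f₁ rfl rfl).frame f₂ rfl rfl).frame f₃ rfl rfl
  have hv₃ : s₃.reg .v = k + 1 + z := ((f₃.reg _ rfl).trans (f₂.reg _ rfl)).trans hv₁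
  refine (runs_loop_emit hflag₃ hs₃ hv₃).seq fun s₄ f₄ hs₄ => ?_
  refine ⟨le_rfl, hs₄.frame (frame_eval _ _) rfl rfl, ?_, ?_⟩
  · simp [Cmd.eval, f₄.reg .v rfl, hv₃]
    omega
  · simp [Cmd.eval, f₄.reg .lit rfl, f₃.reg .lit rfl, f₂.reg .lit rfl, f₁.reg .lit rfl, hz]
    omega

theorem runs_emitVariables (hP : Params k g cs s) (hs : Writing x out s) (hi : s.reg .i = i)
    (hw : s.reg .w = w) :
    Runs emitVariables s (23 * (k * g) + 3) fun s' =>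
      Writing x (out ++ variableLeaves k g i w) s' ∧ s'.reg .v = k + k * g := by
  have hmov : Runs (mov .v .k) s 1 fun s' => s'.reg .v = k :=
    ⟨le_rfl, by simp [eval_mov, hP.reg_k]⟩
  have hset (s' : St) : Runs (set .lit 0) s' 1 fun s' => s'.reg .lit = 0 :=
    ⟨le_rfl, by simp [Cmd.eval]⟩
  refine hmov.seq fun s₁ f₁ hv => (hset s₁).seq fun s₂ f₂ hlit => ?_
  have hP₂ := (hP.frame f₁ (by decide)).frame f₂ (by decide)
  have hs₂ := (hs.frame f₁ rfl rfl).frame f₂ rfl rfl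
  have hi₂ := ((f₂.reg .i rfl).trans (f₁.reg .i rfl)).trans hi
  have hw₂ := ((f₂.reg .w rfl).trans (f₁.reg .w rfl)).trans hw
  rw [variableLeaves, map_filter_eq_flatMap]
  refine ((runs_loop_emits (fun j s' => s'.reg .v = k + j ∧ s'.reg .lit = 2 * j) _ hP₂.reg_kg hs₂
    ⟨(f₂.reg _ rfl).trans hv, hlit⟩ fun j _ s₃ _ f₃ hs₃ h₃ =>
    runs_emitVariable (hP₂.frame f₃ (by decide)) hs₃ ((f₃.reg _ rfl).trans hi₂)
      ((f₃.reg _ rfl).trans hw₂) h₃.1 h₃.2).mono fun s' _ h => ⟨h.1, h.2.1⟩).le_time (by omega)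

end LoopLang

namespace LoopLang

open Cmd SatCover

variable {x out rest : List ℕ} {s : St} {k g i w t y : ℕ} {cs : List (List ℕ)}

/-- Reads a literal, and sets the variable `sat` to `1` if the partial assignment makes it true. -/
def scanLiteral : Cmd := read .lit ;; testLiteral ;; .loop .flag (set .sat 1)

/-- Reads a clause of length `len`, and sets the variable `sat` to `1` if the partial assignment
makes it true. -/
def scanClause : Cmd := .loop .len scanLiteral

/-- Reads the next clause, and writes its leaf if the partial assignment makes the clause true. -/
def emitClause : Cmd :=
  inc .v ;; read .len ;; set .sat 0 ;; scanClause ;; .loop .sat (emit .v)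

/-- Writes the leaves of the clauses that the partial assignment makes true. -/
def emitClauses : Cmd := set .p 2 ;; .loop .m emitClause

theorem runs_scanLiteral {b : Bool} (hP : Params k g cs s) (hs : Writing x out s)
    (hr : Reading x (t :: rest) s) (hi : s.reg .i = i) (hw : s.reg .w = w)
    (hb : s.reg .sat = if b then 1 else 0) :
    Runs scanLiteral s 20 fun s' =>
      Reading x rest s' ∧ s'.reg .sat = if b || agrees g i w t then 1 else 0 := by
  refine (runs_read (r := .lit) (by decide) hs.mem hr).seq fun s₁ f₁ ⟨ht, hr₁⟩ => ?_
  refine (runs_testLiteral (hP.frame f₁ (by decide)) ((f₁.reg _ rfl).trans hi)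
    ((f₁.reg _ rfl).trans hw) ht).seq fun s₂ f₂ hflag => ?_
  have hr₂ := hr₁.frame f₂ rfl
  have hb₂ := ((f₂.reg _ rfl).trans (f₁.reg _ rfl)).trans hb
  refine Runs.loop_ite hflag (fun h => ?_) fun h => ⟨hr₂, by simpa [h] using hb₂⟩
  exact ⟨le_rfl, hr₂.frame (frame_eval _ _) rfl, by simp [Cmd.eval, h]⟩

theorem runs_scanClause {c : List ℕ} (hP : Params k g cs s) (hs : Writing x out s)
    (hr : Reading x (c ++ rest) s) (hi : s.reg .i = i) (hw : s.reg .w = w)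
    (hlen : s.reg .len = c.length) (hsat : s.reg .sat = 0) :
    Runs scanClause s (c.length * 21 + 1) fun s' =>
      Reading x rest s' ∧ s'.reg .sat = if c.any (agrees g i w) then 1 else 0 := by
  refine (Runs.loop (D := 20) (fun j s' => Reading x (c.drop j ++ rest) s' ∧
      s'.reg .sat = if (c.take j).any (agrees g i w) then 1 else 0) hlen
    ⟨hr, hsat⟩ fun j hj s₁ f₁ ⟨hr₁, hsat₁⟩ => ?_).mono fun s' _ h => by simpa using h
  rw [List.drop_eq_getElem_cons hj] at hr₁
  refine (runs_scanLiteral (hP.frame f₁ (by decide)) (hs.frame f₁ rfl rfl) hr₁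
    ((f₁.reg _ rfl).trans hi) ((f₁.reg _ rfl).trans hw) hsat₁).mono fun s₂ _ ⟨hr₂, hsat₂⟩ =>
    ⟨hr₂, ?_⟩
  rw [hsat₂, ← List.take_append_getElem hj, List.any_append, List.any_cons, List.any_nil,
    Bool.or_false]

theorem runs_emitClause {c : List ℕ} (hP : Params k g cs s) (hs : Writing x out s)
    (hr : Reading x (c.length :: c ++ rest) s) (hi : s.reg .i = i) (hw : s.reg .w = w)
    (hv : s.reg .v + 1 = y) :
    Runs emitClause s (c.length * 21 + 9) fun s' =>
      Writing x (out ++ if c.any (agrees g i w) then [y] else []) s' ∧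
        s'.reg .v = y ∧ Reading x rest s' := by
  have hinc : Runs (inc .v) s 1 fun s' => s'.reg .v = y := ⟨le_rfl, by simp [Cmd.eval, hv]⟩
  have hset (s' : St) : Runs (set .sat 0) s' 1 fun s' => s'.reg .sat = 0 :=
    ⟨le_rfl, by simp [Cmd.eval]⟩
  refine hinc.seq fun s₁ f₁ hv₁ => ?_
  have hs₁ := hs.frame f₁ rfl rfl
  refine (runs_read (r := .len) (by decide) hs₁.mem (hr.frame f₁ rfl)).seq
    fun s₂ f₂ ⟨hlen, hr₂⟩ => ?_
  refine (hset s₂).seq fun s₃ f₃ hsat => ?_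
  have hP₃ := ((hP.frame f₁ (by decide)).frame f₂ (by decide)).frame f₃ (by decide)
  have hs₃ := (hs₁.frame f₂ rfl rfl).frame f₃ rfl rfl
  have hi₃ := ((f₃.reg .i rfl).trans ((f₂.reg .i rfl).trans (f₁.reg .i rfl))).trans hi
  have hw₃ := ((f₃.reg .w rfl).trans ((f₂.reg .w rfl).trans (f₁.reg .w rfl))).trans hw
  refine (runs_scanClause hP₃ hs₃ (hr₂.frame f₃ rfl) hi₃ hw₃ ((f₃.reg _ rfl).trans hlen)
    hsat).seq fun s₄ f₄ ⟨hr₄, hsat₄⟩ => ?_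
  have hv₄ := (((f₄.reg .v rfl).trans (f₃.reg .v rfl)).trans (f₂.reg .v rfl)).trans hv₁
  refine ((runs_loop_emit hsat₄ (hs₃.frame f₄ rfl rfl) hv₄).mono fun s' f h =>
    ⟨h, (f.reg _ rfl).trans hv₄, hr₄.frame f rfl⟩).le_time (by omega)

theorem runs_emitClauses {n : ℕ} (hP : Params k g cs s)
    (hs : Writing (cnfEncoding n cs) out s) (hi : s.reg .i = i)
    (hw : s.reg .w = w) (hv : s.reg .v = k + k * g) {L : ℕ} (hL : ∀ c ∈ cs, c.length ≤ L) :
    Runs emitClauses s (cs.length * (L * 21 + 10) + 4)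
      (Writing (cnfEncoding n cs) (out ++ clauseLeaves k g cs i w)) := by
  have hset : Runs (set .p 2) s 3
      (Reading (cnfEncoding n cs) (cs.flatMap fun c => c.length :: c)) :=
    ⟨le_rfl, by simp [Reading, Cmd.eval, cnfEncoding]⟩
  refine hset.seq fun s₁ f₁ hr₁ => ?_
  have hP₁ := hP.frame f₁ (by decide)
  have hs₁ := hs.frame f₁ rfl rfl
  have hi₁ := (f₁.reg .i rfl).trans hi
  have hw₁ := (f₁.reg .w rfl).trans hw
  have hv₁ := (f₁.reg .v rfl).trans hv
  rw [clauseLeaves, map_filter_eq_flatMap]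
  refine ((runs_loop_emits (D := L * 21 + 9) (fun j s' => s'.reg .v = k + k * g + j ∧
    Reading _ ((cs.drop j).flatMap fun c => c.length :: c) s') _ hP₁.reg_m hs₁ ⟨hv₁, hr₁⟩
    fun j hj s₂ _ f₂ hs₂ ⟨hv₂, hr₂⟩ => ?_).mono fun s' _ h => h.1).le_time le_rfl
  rw [List.drop_eq_getElem_cons hj, List.flatMap_cons] at hr₂
  rw [List.getD_eq_getElem _ _ hj]
  refine ((runs_emitClause (y := k + 1 + k * g + j) (hP₁.frame f₂ (by decide)) hs₂ hr₂
    ((f₂.reg _ rfl).trans hi₁) ((f₂.reg _ rfl).trans hw₁) (by omega)).mono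
    fun s' _ h => ⟨h.1, by omega, h.2.2⟩).le_time ?_
  have := hL _ (List.getElem_mem hj)
  omega

end LoopLang

namespace LoopLang

open Cmd SatCover

variable {out : List ℕ} {s : St} {n k g i w L : ℕ} {cs : List (List ℕ)}

/-- Writes the elements of a set of the reduction. -/
def emitMembers : Cmd :=
  emit .zero ;; mov .v .i ;; inc .v ;; emit .v ;; emitVariables ;; emitClauses

/-- Replaces the number at the position `q` of the output by the length of the output behind
it. -/
def patchLength : Cmd := op subOp .a .o .q ;; op subOp .a .a .one ;; store .q .a

/-- Writes a set of the reduction, preceded by its size, and proceeds to the next partial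
assignment. The size is not known in advance and replaces a zero in the end. -/
def emitSet : Cmd :=
  mov .q .o ;; emit .zero ;; emitMembers ;; patchLength ;; inc .w

/-- Writes the sets of the reduction, each preceded by its size. -/
def emitSets : Cmd := set .i 0 ;; .loop .k (set .w 0 ;; .loop .e emitSet ;; inc .i)

theorem runs_emitMembers (hP : Params k g cs s)
    (hs : Writing (cnfEncoding n cs) out s) (hi : s.reg .i = i)
    (hw : s.reg .w = w) (hL : ∀ c ∈ cs, c.length ≤ L) :
    Runs emitMembers s (23 * (k * g) + cs.length * (L * 21 + 10) + 13)
      (Writing (cnfEncoding n cs) (out ++ members k g cs i w)) := by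
  have hlabel (s' : St) (hi' : s'.reg .i = i) :
      Runs (mov .v .i) s' 1 fun s'' => s''.reg .v = i := ⟨le_rfl, by simp [eval_mov, hi']⟩
  have hinc (s' : St) (hv : s'.reg .v = i) :
      Runs (inc .v) s' 1 fun s'' => s''.reg .v = i + 1 := ⟨le_rfl, by simp [Cmd.eval, hv]⟩
  refine (runs_emit hs hP.reg_zero).seq fun s₁ f₁ hs₁ => ?_
  have hi₁ := (f₁.reg .i rfl).trans hi
  refine (hlabel s₁ hi₁).seq fun s₂ f₂ hv₂ => (hinc s₂ hv₂).seq fun s₃ f₃ hv₃ => ?_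
  refine (runs_emit ((hs₁.frame f₂ rfl rfl).frame f₃ rfl rfl) hv₃).seq fun s₄ f₄ hs₄ => ?_
  have hi₄ := (f₄.reg .i rfl).trans ((f₃.reg .i rfl).trans ((f₂.reg .i rfl).trans hi₁))
  have hw₄ := (f₄.reg .w rfl).trans ((f₃.reg .w rfl).trans
    ((f₂.reg .w rfl).trans ((f₁.reg .w rfl).trans hw)))
  have hP₄ := (((hP.frame f₁ (by decide)).frame f₂ (by decide)).frame f₃ (by decide)).frame f₄
    (by decide)
  refine (runs_emitVariables hP₄ hs₄ hi₄ hw₄).seq fun s₅ f₅ ⟨hs₅, hv₅⟩ => ?_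
  refine ((runs_emitClauses (hP₄.frame f₅ (by decide)) hs₅ ((f₅.reg _ rfl).trans hi₄)
    ((f₅.reg _ rfl).trans hw₄) hv₅ hL).mono fun s' _ h => ?_).le_time (by omega)
  simpa only [members, List.append_assoc, List.cons_append, List.nil_append] using h

theorem runs_patchLength {x ys : List ℕ} {z : ℕ} (hs : Writing x (out ++ z :: ys) s)
    (hq : s.reg .q = (x ++ out).length) (hone : s.reg .one = 1) :
    Runs patchLength s 3 (Writing x (out ++ ys.length :: ys)) := by
  refine ⟨le_rfl, ?_⟩
  have ho : s.reg .o = (x ++ out).length + (ys.length + 1) := by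
    simp only [hs.o, List.length_append, List.length_cons, Nat.add_assoc]
  simp only [patchLength, Cmd.eval, subOp, RAM.Op.eval, Function.update_self, ho, hq, hone,
    Function.update_of_ne (show Reg.one ≠ .a by decide),
    Function.update_of_ne (show Reg.q ≠ .a by decide), Nat.add_sub_cancel_left, Nat.add_sub_cancel]
  exact ⟨(hs.update_mem _).mem, by simpa using (hs.update_mem ys.length).o⟩

theorem runs_emitSet (hP : Params k g cs s) (hs : Writing (cnfEncoding n cs) out s)
    (hi : s.reg .i = i) (hw : s.reg .w = w) (hL : ∀ c ∈ cs, c.length ≤ L) :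
    Runs emitSet s (23 * (k * g) + cs.length * (L * 21 + 10) + 20) fun s' =>
      Writing (cnfEncoding n cs)
          (out ++ (members k g cs i w).length :: members k g cs i w) s' ∧
        s'.reg .w = w + 1 := by
  have hmov : Runs (mov .q .o) s 1 fun s' => s'.reg .q = (cnfEncoding n cs ++ out).length :=
    ⟨le_rfl, by simp only [eval_mov, Function.update_self, hs.o]⟩
  refine hmov.seq fun s₁ f₁ hq₁ => ?_
  have hP₁ := hP.frame f₁ (by decide)
  refine (runs_emit (hs.frame f₁ rfl rfl) hP₁.reg_zero).seq fun s₂ f₂ hs₂ => ?_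
  have hP₂ := hP₁.frame f₂ (by decide)
  refine (runs_emitMembers hP₂ hs₂ ((f₂.reg .i rfl).trans ((f₁.reg .i rfl).trans hi))
    ((f₂.reg .w rfl).trans ((f₁.reg .w rfl).trans hw)) hL).seq fun s₃ f₃ hs₃ => ?_
  rw [List.append_assoc, List.singleton_append] at hs₃
  have hq₃ := (f₃.reg .q rfl).trans ((f₂.reg .q rfl).trans hq₁)
  refine (runs_patchLength hs₃ hq₃ (hP₂.frame f₃ (by decide)).reg_one).seq fun s₄ f₄ hs₄ => ?_
  have hw₄ := (f₄.reg .w rfl).trans ((f₃.reg .w rfl).trans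
    ((f₂.reg .w rfl).trans ((f₁.reg .w rfl).trans hw)))
  have hnext : Runs (inc .w) s₄ 1 fun s' => Writing (cnfEncoding n cs)
      (out ++ (members k g cs i w).length :: members k g cs i w) s' ∧ s'.reg .w = w + 1 :=
    ⟨le_rfl, hs₄.frame (frame_eval _ _) rfl rfl, by simp [Cmd.eval, hw₄]⟩
  exact hnext.le_time (by omega)

theorem runs_emitSets (hP : Params k g cs s)
    (hs : Writing (cnfEncoding n cs) out s)
    (hL : ∀ c ∈ cs, c.length ≤ L) :
    Runs emitSets s
      (k * (2 ^ g * (23 * (k * g) + cs.length * (L * 21 + 10) + 20 + 1) + 3 + 1) + 2)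
      (Writing (cnfEncoding n cs)
        (out ++ (objects k g cs).flatMap fun s => s.length :: s)) := by
  have hset (r : Reg) (s' : St) : Runs (set r 0) s' 1 fun s'' => s''.reg r = 0 :=
    ⟨le_rfl, by simp [Cmd.eval]⟩
  refine (hset .i s).seq fun s₁ f₁ hi₁ => ?_
  have hP₁ := hP.frame f₁ (by decide)
  simp only [objects, List.flatMap_assoc, List.flatMap_map]
  refine ((runs_loop_emits (D := 2 ^ g * (23 * (k * g) + cs.length * (L * 21 + 10) + 20 + 1) + 3)
    (fun j s' => s'.reg .i = j) _ hP₁.reg_k (hs.frame f₁ rfl rfl) hi₁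
    fun i _ s₂ out' f₂ hs₂ hi₂ => ?_).mono fun s' _ h => h.1).le_time (by omega)
  refine (hset .w s₂).seq fun s₃ f₃ hw₃ => ?_
  have hP₃ := (hP₁.frame f₂ (by decide)).frame f₃ (by decide)
  refine (runs_loop_emits (fun j s' => s'.reg .w = j) _ hP₃.reg_e (hs₂.frame f₃ rfl rfl) hw₃
    fun w _ s₄ out'' f₄ hs₄ hw₄ => runs_emitSet (hP₃.frame f₄ (by decide)) hs₄
      ((f₄.reg .i rfl).trans ((f₃.reg .i rfl).trans hi₂)) hw₄ hL).seq fun s₅ f₅ hs₅ => ?_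
  have hi₅ := (f₅.reg .i rfl).trans ((f₃.reg .i rfl).trans hi₂)
  have hnext : Runs (inc .i) s₅ 1 fun s' => Writing (cnfEncoding n cs) (out' ++
      (List.range (2 ^ g)).flatMap fun w => (members k g cs i w).length :: members k g cs i w) s' ∧
        s'.reg .i = i + 1 :=
    ⟨le_rfl, hs₅.1.frame (frame_eval _ _) rfl rfl, by simp [Cmd.eval, hi₅]⟩
  exact hnext.le_time (by omega)

end LoopLang

/-! ### The reduction -/

namespace LoopLang

open Cmd SatCover

variable {x out : List ℕ} {s s' : St} {n k g N t : ℕ} {cs : List (List ℕ)}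

/-- Reads the numbers of variables and of clauses, and sets the number and the size of the
groups. -/
def readParameters (k : ℕ) : Cmd :=
  set .zero 0 ;; set .one 1 ;; set .two 2 ;; set .k k ;; load .n .zero ;; load .m .one ;;
    op divOp .g .n .k ;; inc .g

/-- Finds the end of the input. -/
def findEnd : Cmd :=
  set .p 2 ;; .loop .m (load .len .p ;; addTo .p .len ;; inc .p) ;; mov .base .p ;; mov .o .p

/-- Computes the numbers of variables of all groups, of partial assignments, of leaves of the star
and of sets. -/
def computeSizes : Cmd :=
  addMulTo .kg .k .g ;; mov .u .k ;; addTo .u .kg ;; addTo .u .m ;; powTwo .e .g ;;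
    addMulTo .total .k .e

/-- Writes the edges of the star. -/
def emitEdges : Cmd := set .v 0 ;; .loop .u (emit .zero ;; inc .v ;; emit .v)

/-- Writes everything that precedes the sets. -/
def emitHeader : Cmd :=
  (emit .k ;; mov .a .u ;; inc .a ;; emit .a ;; emit .u) ;; emitEdges ;; emit .total

/-- Moves the output to the beginning of the memory and erases everything else. -/
def moveOutput : Cmd :=
  (op subOp .len .o .base ;; mov .v .base ;; set .a 0) ;;
    .loop .len (load .b .v ;; inc .v ;; store .a .b ;; inc .a) ;;
    .loop .base (store .a .zero ;; inc .a)

/-- Replaces a formula by the instance of the covering problem for `k` groups. -/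
def reduction (k : ℕ) : Cmd :=
  readParameters k ;; findEnd ;; computeSizes ;; emitHeader ;; emitSets ;; moveOutput

theorem runs_readParameters (hm : ∀ a, s.mem a = (cnfEncoding n cs).getD a 0) :
    Runs (readParameters k) s (k + 11) fun s' => s'.reg .zero = 0 ∧ s'.reg .one = 1 ∧
      s'.reg .two = 2 ∧ s'.reg .k = k ∧ s'.reg .m = cs.length ∧ s'.reg .g = n / k + 1 := by
  refine ⟨by simp only [readParameters, Cmd.time]; omega, ?_⟩
  simp [readParameters, Cmd.eval, divOp, RAM.Op.eval, hm, cnfEncoding]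

theorem runs_findEnd {L : ℕ} (hm : ∀ a, s.mem a = (cnfEncoding n cs).getD a 0)
    (hcs : s.reg .m = cs.length) (hL : ∀ c ∈ cs, c.length ≤ L) :
    Runs findEnd s (cs.length * (2 * L + 3 + 1) + 6) fun s' =>
      Writing (cnfEncoding n cs) [] s' ∧ s'.reg .base = (cnfEncoding n cs).length := by
  set x := cnfEncoding n cs
  let rest (j : ℕ) := (cs.drop j).flatMap fun c => c.length :: c
  have hset : Runs (set .p 2) s 3 fun s' =>
      s'.reg .p + (rest 0).length = x.length ∧ Reading x (rest 0) s' :=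
    ⟨le_rfl, Nat.add_comm _ _, rfl⟩
  refine hset.seq fun s₁ f₁ h₁ => ?_
  refine (Runs.loop (D := 2 * L + 3)
    (fun j s' => s'.reg .p + (rest j).length = x.length ∧ Reading x (rest j) s')
    ((f₁.reg _ rfl).trans hcs) h₁ fun j hj s₂ f₂ ⟨hp₂, hr₂⟩ => ?_).seq fun s₂ f₂ ⟨hp₂, _⟩ => ?_
  · have hm₂ (a : ℕ) : s₂.mem a = (x ++ []).getD a 0 := by
      rw [f₂.mem rfl, f₁.mem rfl, hm, List.append_nil]
    have hrest : rest j = cs[j].length :: (cs[j] ++ rest (j + 1)) := by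
      simp only [rest, List.drop_eq_getElem_cons hj, List.flatMap_cons, List.cons_append]
    rw [hrest] at hp₂ hr₂
    have hload : Runs (load .len .p) s₂ 1 fun s' => s'.reg .len = cs[j].length :=
      ⟨le_rfl, by simp [Cmd.eval, hr₂.mem_eq hm₂]⟩
    have := hL _ (List.getElem_mem hj)
    refine hload.seq fun s₃ f₃ hlen₃ => ?_
    refine (runs_addTo (f₃.reg _ rfl) hlen₃).seq fun s₄ _ hp₄ => ?_
    have hinc : Runs (inc .p) s₄ 1 fun s' => s'.reg .p = s₂.reg .p + (cs[j].length + 1) :=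
      ⟨le_rfl, by simp [Cmd.eval, hp₄, add_assoc]⟩
    refine (hinc.mono fun s' _ hp' => ?_).le_time (by omega)
    rw [hp', Reading, hp', ← List.drop_drop, hr₂, List.drop_succ_cons, List.drop_left]
    exact ⟨by simp only [List.length_cons, List.length_append] at hp₂; omega, rfl⟩
  · have hp : s₂.reg .p = x.length := by simpa [rest] using hp₂
    have hmem : s₂.mem = s.mem := (f₂.mem rfl).trans (f₁.mem rfl)
    have hmov : Runs (mov .base .p ;; mov .o .p) s₂ 2 fun s' =>
        Writing x [] s' ∧ s'.reg .base = x.length := by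
      refine ⟨le_rfl, ⟨?_, ?_⟩, ?_⟩ <;> simp [Cmd.eval, eval_mov, hp, hmem, hm]
    exact hmov.le_time (by omega)

theorem runs_computeSizes (hk : s.reg .k = k) (hg : s.reg .g = g) (hm : s.reg .m = cs.length)
    (hkg : s.reg .kg = 0) (ht : s.reg .total = 0) :
    Runs computeSizes s
      (k * (2 * g + 2) + 2 * (k * g) + 2 * cs.length + g * (2 * 2 ^ g + 2) +
        k * (2 * 2 ^ g + 2) + 8) fun s' =>
        s'.reg .kg = k * g ∧ s'.reg .e = 2 ^ g ∧ s'.reg .u = leaves k g cs ∧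
          s'.reg .total = k * 2 ^ g := by
  have hmov (s' : St) (hk : s'.reg .k = k) : Runs (mov .u .k) s' 1 fun s'' => s''.reg .u = k :=
    ⟨le_rfl, by simp [eval_mov, hk]⟩
  refine (runs_addMulTo (by decide) hkg hk hg).seq fun s₁ f₁ hkg₁ => ?_
  rw [zero_add] at hkg₁
  refine (hmov s₁ ((f₁.reg _ rfl).trans hk)).seq fun s₂ f₂ hu₂ => ?_
  have hkg₂ := (f₂.reg .kg rfl).trans hkg₁
  refine (runs_addTo hu₂ hkg₂).seq fun s₃ f₃ hu₃ => ?_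
  have hm₃ := (f₃.reg .m rfl).trans ((f₂.reg .m rfl).trans ((f₁.reg .m rfl).trans hm))
  refine (runs_addTo hu₃ hm₃).seq fun s₄ f₄ hu₄ => ?_
  have hg₄ := (f₄.reg .g rfl).trans
    ((f₃.reg .g rfl).trans ((f₂.reg .g rfl).trans ((f₁.reg .g rfl).trans hg)))
  refine (runs_powTwo (by decide) hg₄).seq fun s₅ f₅ he₅ => ?_
  have hk₅ := (f₅.reg .k rfl).trans ((f₄.reg .k rfl).trans
    ((f₃.reg .k rfl).trans ((f₂.reg .k rfl).trans ((f₁.reg .k rfl).trans hk))))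
  have ht₅ := (f₅.reg .total rfl).trans ((f₄.reg .total rfl).trans
    ((f₃.reg .total rfl).trans ((f₂.reg .total rfl).trans ((f₁.reg .total rfl).trans ht))))
  have hkg₅ := (f₅.reg .kg rfl).trans ((f₄.reg .kg rfl).trans ((f₃.reg .kg rfl).trans hkg₂))
  refine ((runs_addMulTo (by decide) ht₅ hk₅ he₅).mono fun s' f ht' => ?_).le_time (by omega)
  exact ⟨(f.reg _ rfl).trans hkg₅, (f.reg _ rfl).trans he₅,
    (f.reg _ rfl).trans ((f₅.reg _ rfl).trans hu₄), by simpa using ht'⟩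

theorem runs_emitEdges (hs : Writing x out s) (hz : s.reg .zero = 0) (hu : s.reg .u = N) :
    Runs emitEdges s (6 * N + 2)
      (Writing x (out ++ (List.range N).flatMap (fun v => [0, v + 1]))) := by
  have hset : Runs (set .v 0) s 1 fun s' => s'.reg .v = 0 := ⟨le_rfl, by simp [Cmd.eval]⟩
  refine hset.seq fun s₁ f₁ hv₁ => ?_
  have hs₁ := hs.frame f₁ rfl rfl
  refine ((runs_loop_emits (D := 5) (fun j s' => s'.reg .v = j) _ ((f₁.reg _ rfl).trans hu) hs₁ hv₁
    fun j _ s₂ out' f₂ hs₂ hv₂ => ?_).mono fun s' _ h => h.1).le_time (by omega)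
  have hz₂ := (f₂.reg .zero rfl).trans ((f₁.reg .zero rfl).trans hz)
  have hinc (s' : St) (hv : s'.reg .v = j) : Runs (inc .v) s' 1 fun s'' => s''.reg .v = j + 1 :=
    ⟨le_rfl, by simp [Cmd.eval, hv]⟩
  refine (runs_emit hs₂ hz₂).seq fun s₃ f₃ hs₃ => ?_
  refine (hinc s₃ ((f₃.reg _ rfl).trans hv₂)).seq fun s₄ f₄ hv₄ => ?_
  refine (runs_emit (hs₃.frame f₄ rfl rfl) hv₄).mono fun s' f h => ⟨?_, (f.reg _ rfl).trans hv₄⟩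
  rwa [List.append_assoc] at h

theorem runs_emitHeader (hs : Writing x out s) (hz : s.reg .zero = 0) (hk : s.reg .k = k)
    (hu : s.reg .u = N) (ht : s.reg .total = t) :
    Runs emitHeader s (6 * N + 12) (Writing x
      (out ++ ([k, N + 1, N] ++ (List.range N).flatMap (fun v => [0, v + 1]) ++ [t]))) := by
  have hcounts : Runs (emit .k ;; mov .a .u ;; inc .a ;; emit .a ;; emit .u) s 8
      (Writing x (out ++ [k] ++ [N + 1] ++ [N])) := by
    have hmov (s' : St) (hu : s'.reg .u = N) :
        Runs (mov .a .u) s' 1 fun s'' => s''.reg .a = N := ⟨le_rfl, by simp [eval_mov, hu]⟩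
    have hinc (s' : St) (ha : s'.reg .a = N) : Runs (inc .a) s' 1 fun s'' => s''.reg .a = N + 1 :=
      ⟨le_rfl, by simp [Cmd.eval, ha]⟩
    refine (runs_emit hs hk).seq fun s₁ f₁ hs₁ => ?_
    refine (hmov s₁ ((f₁.reg _ rfl).trans hu)).seq fun s₂ f₂ ha₂ => ?_
    refine (hinc s₂ ha₂).seq fun s₃ f₃ ha₃ => ?_
    refine (runs_emit ((hs₁.frame f₂ rfl rfl).frame f₃ rfl rfl) ha₃).seq fun s₄ f₄ hs₄ => ?_
    exact runs_emit hs₄ ((f₄.reg .u rfl).trans ((f₃.reg .u rfl).trans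
      ((f₂.reg .u rfl).trans ((f₁.reg .u rfl).trans hu))))
  refine hcounts.seq fun s₁ f₁ hs₁ => ?_
  refine (runs_emitEdges hs₁ ((f₁.reg _ rfl).trans hz) ((f₁.reg _ rfl).trans hu)).seq
    fun s₂ f₂ hs₂ => ?_
  have ht₂ := (f₂.reg .total rfl).trans ((f₁.reg .total rfl).trans ht)
  refine ((runs_emit hs₂ ht₂).mono fun s' _ h => ?_).le_time (by omega)
  simpa only [List.append_assoc, List.cons_append, List.nil_append] using h

/-- The first `t` numbers of the output have been moved to the beginning of the memory, where those
behind the end of the output count as zeros. -/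
def Moved (x out : List ℕ) (t : ℕ) (s : St) : Prop :=
  (∀ a, s.mem a = (if a < t then out else x ++ out).getD a 0) ∧ s.reg .a = t

theorem Moved.frame {c : Cmd} (h : Moved x out t s) (hf : Frame c s s') (ha : c.keeps .a)
    (hc : c.storeFree) : Moved x out t s' :=
  ⟨fun a => (congrFun (hf.mem hc) a).trans (h.1 a), (hf.reg _ ha).trans h.2⟩

theorem Moved.update (h : Moved x out t s) {r : Reg} (hr : s.reg r = out.getD t 0) :
    Moved x out (t + 1) ((store .a r ;; inc .a).eval s) := by
  refine ⟨fun a => ?_, by simp [Cmd.eval, h.2]⟩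
  rcases eq_or_ne a t with rfl | ha
  · simp [Cmd.eval, h.2, hr]
  · simp [Cmd.eval, h.2, ha, h.1, show a < t + 1 ↔ a < t by omega, -Order.lt_add_one_iff]

theorem runs_moveOutput (hs : Writing x out s) (hz : s.reg .zero = 0)
    (hb : s.reg .base = x.length) :
    Runs moveOutput s (5 * out.length + 3 * x.length + 5) fun s' =>
      ∀ a, s'.mem a = out.getD a 0 := by
  have hset : Runs (op subOp .len .o .base ;; mov .v .base ;; set .a 0) s 3 fun s' =>
      s'.reg .len = out.length ∧ s'.reg .v = x.length ∧ Moved x out 0 s' := by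
    refine ⟨le_rfl, ?_, ?_, fun a => ?_, ?_⟩ <;>
      simp [Cmd.eval, eval_mov, subOp, RAM.Op.eval, hb, hs.o, hs.mem]
  refine hset.seq fun s₁ f₁ ⟨hlen₁, hv₁, hm₁⟩ => ?_
  refine (Runs.loop (D := 4) (fun j s' => s'.reg .v = x.length + j ∧ Moved x out j s') hlen₁
    ⟨hv₁, hm₁⟩ fun j _ s₂ _ ⟨hv₂, hm₂⟩ => ?_).seq fun s₂ f₂ ⟨_, hm₂⟩ => ?_
  · have hload : Runs (load .b .v) s₂ 1 fun s' => s'.reg .b = out.getD j 0 := by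
      refine ⟨le_rfl, ?_⟩
      simp [Cmd.eval, hv₂, hm₂.1, List.getElem?_append_right]
    have hinc (s' : St) (hv : s'.reg .v = x.length + j) :
        Runs (inc .v) s' 1 fun s'' => s''.reg .v = x.length + (j + 1) :=
      ⟨le_rfl, by simp [Cmd.eval, hv, add_assoc]⟩
    refine hload.seq fun s₃ f₃ hb₃ => ?_
    refine (hinc s₃ ((f₃.reg _ rfl).trans hv₂)).seq fun s₄ f₄ hv₄ => ?_
    refine ⟨le_rfl, ((frame_eval _ _).reg _ rfl).trans hv₄,
      ((hm₂.frame f₃ rfl rfl).frame f₄ rfl rfl).update ((f₄.reg _ rfl).trans hb₃)⟩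
  · have hz₂ := (f₂.reg .zero rfl).trans ((f₁.reg .zero rfl).trans hz)
    have hb₂ := (f₂.reg .base rfl).trans ((f₁.reg .base rfl).trans hb)
    refine ((Runs.loop (D := 2) (fun j s' => Moved x out (out.length + j) s') hb₂ hm₂
      fun j _ s₃ f₃ hm₃ => ⟨le_rfl, hm₃.update ?_⟩).mono fun s' _ h a => ?_).le_time (by omega)
    · simp [f₃.reg .zero rfl, hz₂]
    · rw [h.1]
      split_ifs with ha
      · rfl
      · rw [List.getD_eq_default _ _ (by simp only [List.length_append]; omega),
          List.getD_eq_default _ _ (by omega)]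

theorem reduction_time_le {Z m l N o : ℕ} (hZ : 1 ≤ Z) (hk : k ≤ Z) (hg : g ≤ Z) (hkg : k * g ≤ Z)
    (hm : m ≤ Z) (hl : l ≤ Z) (hN : N ≤ 3 * Z) (ho : o ≤ 4 + 2 * N + k * 2 ^ g * (k * g + m + 3)) :
    (k + 11) + (m * (2 * Z + 3 + 1) + 6) +
      (k * (2 * g + 2) + 2 * (k * g) + 2 * m + g * (2 * 2 ^ g + 2) + k * (2 * 2 ^ g + 2) + 8) +
      (6 * N + 12) + (k * (2 ^ g * (23 * (k * g) + m * (Z * 21 + 10) + 20 + 1) + 3 + 1) + 2) +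
      (5 * o + 3 * l + 5) ≤ 250 * Z ^ 3 * 2 ^ g := by
  obtain ⟨z, rfl⟩ := Nat.exists_eq_add_of_le hZ
  obtain ⟨e, he⟩ := Nat.exists_eq_add_of_le (Nat.one_le_two_pow (n := g))
  rw [he] at ho ⊢
  have ho' : o ≤ 4 + 2 * (3 * (1 + z)) + (1 + z) * (1 + e) * (2 * (1 + z) + 3) :=
    ho.trans (by gcongr; omega)
  calc _ ≤ ((1 + z) + 11) + ((1 + z) * (2 * (1 + z) + 3 + 1) + 6) +
      ((1 + z) * (2 * (1 + z) + 2) + 2 * (1 + z) + 2 * (1 + z) + (1 + z) * (2 * (1 + e) + 2) +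
        (1 + z) * (2 * (1 + e) + 2) + 8) +
      (6 * (3 * (1 + z)) + 12) + ((1 + z) *
        ((1 + e) * (23 * (1 + z) + (1 + z) * ((1 + z) * 21 + 10) + 20 + 1) + 3 + 1) + 2) +
      (5 * (4 + 2 * (3 * (1 + z)) + (1 + z) * (1 + e) * (2 * (1 + z) + 3)) + 3 * (1 + z) + 5) := by
        gcongr
    _ ≤ _ := by
        zify
        rw [← sub_nonneg]
        ring_nf
        positivity

theorem runs_reduction {Z : ℕ} (hm : ∀ a, s.mem a = (cnfEncoding n cs).getD a 0)
    (hs : ∀ r, s.reg r = 0) (hg : n / k + 1 = g) (hk : 1 ≤ k)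
    (hZ : (cnfEncoding n cs).length + k + k * g ≤ Z) :
    Runs (reduction k) s (250 * Z ^ 3 * 2 ^ g)
      fun s' => ∀ a, s'.mem a = (satEncoding k g cs).getD a 0 := by
  have hgZ : g ≤ k * g := Nat.le_mul_of_pos_left g hk
  have hmZ := length_add_two_le_length_cnfEncoding (n := n) (cs := cs)
  have hL (c) (hc : c ∈ cs) : c.length ≤ Z := by
    have := length_le_length_cnfEncoding (n := n) hc
    omega
  have htime := reduction_time_le (k := k) (g := g) (Z := Z) (by omega) (by omega) (by omega)
    (by omega) (m := cs.length) (by omega) (l := (cnfEncoding n cs).length) (by omega)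
    (N := leaves k g cs) (by rw [leaves]; omega) length_satEncoding_le
  refine (runs_readParameters hm).seq fun s₁ f₁ ⟨hzero₁, hone₁, htwo₁, hk₁, hm₁, hg₁⟩ => ?_
  rw [hg] at hg₁
  refine (runs_findEnd (fun a => (congrFun (f₁.mem rfl) a).trans (hm a)) hm₁ hL).seq
    fun s₂ f₂ ⟨hs₂, hb₂⟩ => ?_
  refine (runs_computeSizes ((f₂.reg _ rfl).trans hk₁) ((f₂.reg _ rfl).trans hg₁)
    ((f₂.reg _ rfl).trans hm₁) ((f₂.reg _ rfl).trans ((f₁.reg _ rfl).trans (hs _)))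
    ((f₂.reg _ rfl).trans ((f₁.reg _ rfl).trans (hs _)))).seq
    fun s₃ f₃ ⟨hkg₃, he₃, hu₃, ht₃⟩ => ?_
  have hs₃ := hs₂.frame f₃ rfl rfl
  have hP₃ : Params k g cs s₃ := by
    have keep (r : Reg) (h : findEnd.keeps r) (h' : computeSizes.keeps r) : s₃.reg r = s₁.reg r :=
      (f₃.reg r h').trans (f₂.reg r h)
    exact ⟨(keep _ rfl rfl).trans hzero₁, (keep _ rfl rfl).trans hone₁,
      (keep _ rfl rfl).trans htwo₁, (keep _ rfl rfl).trans hk₁, (keep _ rfl rfl).trans hg₁, hkg₃,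
      (keep _ rfl rfl).trans hm₁, he₃⟩
  refine (runs_emitHeader hs₃ hP₃.reg_zero hP₃.reg_k hu₃ ht₃).seq fun s₄ f₄ hs₄ => ?_
  have hP₄ := hP₃.frame f₄ (by decide)
  refine (runs_emitSets hP₄ hs₄ hL).seq fun s₅ f₅ hs₅ => ?_
  have hb₅ := (f₅.reg .base rfl).trans ((f₄.reg .base rfl).trans ((f₃.reg .base rfl).trans hb₂))
  have hout : [] ++ ([k, leaves k g cs + 1, leaves k g cs] ++
      (List.range (leaves k g cs)).flatMap (fun v => [0, v + 1]) ++ [k * 2 ^ g]) ++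
      (objects k g cs).flatMap (fun s => s.length :: s) = satEncoding k g cs := by
    rw [satEncoding, starEncoding, length_objects, List.nil_append]
  rw [hout] at hs₅
  exact (runs_moveOutput hs₅ (hP₄.frame f₅ (by decide)).reg_zero hb₅).le_time (by omega)

end LoopLang

/-! ### Running a program on the result of a reduction -/

namespace RAM

/-- The instruction with its jump target moved by `d` lines. -/
def Instr.shift (d : ℕ) : Instr → Instr
  | .jz r l => .jz r (l + d)
  | i => i

/-- Instructions that set the first `N` registers to `0`. -/
def clearRegisters (N : ℕ) : Program := (List.range N).map (Instr.const · 0)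

theorem length_clearRegisters (N : ℕ) : (clearRegisters N).length = N := by
  rw [clearRegisters, List.length_map, List.length_range]

variable {P : Program} {σ τ : Config} {t : ℕ}

theorem Instr.cost_shift (i : Instr) (d pc : ℕ) (σ : Config) :
    (i.shift d).cost { σ with pc := pc } = i.cost σ := by
  cases i <;> rfl

theorem Instr.exec_shift (i : Instr) (d : ℕ) (σ : Config) :
    (i.shift d).exec { σ with pc := d + σ.pc } = { i.exec σ with pc := d + (i.exec σ).pc } := by
  cases i with
  | jz r l =>
    simp only [Instr.shift, Instr.exec]
    split_ifs <;> simp [add_comm, add_assoc]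
  | _ => rfl

theorem HaltsIn.append_shift (h : HaltsIn P σ t τ) {Q : Program} {d : ℕ} (hQ : Q.length = d) :
    HaltsIn (Q ++ P.map (Instr.shift d)) { σ with pc := d + σ.pc } t
      { τ with pc := d + τ.pc } := by
  subst hQ
  induction h with
  | halt σ h => exact .halt _ (by simpa using h)
  | step σ τ i t h _ ih =>
    rw [← i.cost_shift Q.length (Q.length + σ.pc) σ]
    refine .step _ _ (i.shift Q.length) _ ?_ (i.exec_shift Q.length σ ▸ ih)
    rw [List.getElem?_append_right (Nat.le_add_right _ _), Nat.add_sub_cancel_left,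
      List.getElem?_map, h, Option.map_some]

theorem reachesWithin_clearRegisters {l N : ℕ} (hl : σ.pc = l)
    (h : CodeAt P l (clearRegisters N)) :
    ReachesWithin P σ N ⟨l + N, fun q => if q < N then 0 else σ.reg q, σ.mem⟩ := by
  subst hl
  induction N with
  | zero => exact .refl P σ
  | succ N ih =>
    rw [clearRegisters, List.range_succ, List.map_append, codeAt_append, List.length_map,
      List.length_range] at h
    have hstep := ReachesWithin.step (codeAt_cons.1 h.2).1
      (σ := ⟨σ.pc + N, fun q => if q < N then 0 else σ.reg q, σ.mem⟩)
    convert (ih h.1).trans hstep using 1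
    · simp [Instr.cost]
    simp only [Instr.exec, add_assoc, Config.mk.injEq, and_true, true_and]
    funext q
    rcases lt_trichotomy q N with hq | rfl | hq
    · simp [hq, hq.ne, hq.trans (Nat.lt_succ_self N)]
    · simp
    · simp [hq.not_gt, hq.ne', show ¬ q < N + 1 by omega]

end RAM

namespace LoopLang

open RAM

/-- The program that runs the command `c` and then `P`, which finds all registers cleared and the
memory as `c` has left it. -/
def Cmd.andThen (c : Cmd) (P : Program) : Program :=
  c.compile 0 ++ clearRegisters (26 + c.size) ++ P.map (Instr.shift (c.size + (26 + c.size)))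

/-- The state of the loop language in which a computation with input `x` begins. -/
def start (x : List ℕ) : St := ⟨fun _ => 0, (x.getD · 0)⟩

variable {c : Cmd} {P : Program} {x y : List ℕ} {V T : ℕ}

theorem reachesWithin_andThen (hx : ∀ a, x.getD a 0 ≤ V)
    (hc : Runs c (start x) T fun s => ∀ a, s.mem a = y.getD a 0) :
    ReachesWithin (c.andThen P) (init x) ((7 + 3 * (V + T).size) * T + (26 + c.size))
      { init y with pc := c.size + (26 + c.size) } := by
  have hcode : CodeAt (c.andThen P) 0 (c.andThen P) := codeAt_self _
  rw [Cmd.andThen, codeAt_append, codeAt_append, c.length_compile, zero_add] at hcode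
  obtain ⟨σ, hσ, hpc, hsim, hsame⟩ := correct c (V := V) (W := V + T) hcode.1.1
    (s := start x) (σ := init x) ⟨rfl, fun _ => rfl⟩ ⟨hx, fun _ => Nat.zero_le V⟩
    (Nat.add_le_add_left hc.1 V)
  replace hpc : σ.pc = c.size := hpc.trans (zero_add _)
  have hclear := reachesWithin_clearRegisters hpc hcode.1.2
  have hreg : (fun q => if q < 26 + c.size then 0 else σ.reg q) = fun _ => 0 := by
    funext q
    split_ifs with hq
    · rfl
    · obtain ⟨j, rfl⟩ := Nat.exists_eq_add_of_le (show 26 ≤ q by omega)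
      exact hsame j (by simp only [init]; omega)
  have hmem : σ.mem = (y.getD · 0) := hsim.mem.trans (funext hc.2)
  rw [hreg, hmem] at hclear
  exact (hσ.trans hclear).mono (by gcongr; exact hc.1)

theorem decidesWithin_andThen {p : Prop} {B : ℝ} (hx : ∀ a, x.getD a 0 ≤ V)
    (hc : Runs c (start x) T fun s => ∀ a, s.mem a = y.getD a 0) (h : DecidesWithin P y p B) :
    DecidesWithin (c.andThen P) x p
      (((7 + 3 * (V + T).size) * T + (26 + c.size) : ℕ) + B) := by
  obtain ⟨t, τ, ht, hB, hτ⟩ := h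
  have hP := ht.append_shift (Q := c.compile 0 ++ clearRegisters (26 + c.size))
    (by rw [List.length_append, c.length_compile, length_clearRegisters])
  obtain ⟨t', ht', hP'⟩ := reachesWithin_andThen hx hc t _ hP
  refine ⟨t', _, hP', ?_, hτ⟩
  calc (t' : ℝ) ≤ ((7 + 3 * (V + T).size) * T + (26 + c.size) : ℕ) + (t : ℝ) := by
        exact_mod_cast ht'
    _ ≤ _ := by gcongr

end LoopLang

/-! ### The running time -/

theorem RAM.DecidesWithin.mono {P : RAM.Program} {x : List ℕ} {p : Prop} {T T' : ℝ}
    (h : RAM.DecidesWithin P x p T) (hT : T ≤ T') : RAM.DecidesWithin P x p T' :=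
  let ⟨t, τ, ht, h⟩ := h
  ⟨t, τ, ht, h.1.trans hT, h.2⟩

theorem exists_pow_mul_pow_le {ρ θ : ℝ} (hρ : 0 < ρ) (hρθ : ρ < θ) (d : ℕ) :
    ∃ D : ℝ, 0 ≤ D ∧ ∀ n : ℕ, ρ ^ n * ((n : ℝ) + 1) ^ d ≤ D * θ ^ n := by
  have hθ : 0 < θ := hρ.trans hρθ
  have hr₀ : 0 < ρ / θ := div_pos hρ hθ
  have hr : |ρ / θ| < 1 := by rwa [abs_of_pos hr₀, div_lt_one hθ]
  obtain ⟨b, hb⟩ := (tendsto_pow_const_mul_const_pow_of_abs_lt_one d hr).bddAbove_range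
  have hb' (n : ℕ) : (n : ℝ) ^ d * (ρ / θ) ^ n ≤ b := hb ⟨n, rfl⟩
  have hb₀ : 0 ≤ b := le_trans (by positivity) (hb' 1)
  refine ⟨b / (ρ / θ), by positivity, fun n => ?_⟩
  have := hb' (n + 1)
  rwa [Nat.cast_succ, pow_succ, ← mul_assoc, ← le_div_iff₀ hr₀, div_pow, ← mul_div_assoc,
    div_le_iff₀ (by positivity), mul_comm (_ ^ d)] at this

theorem not_SETH_of_decidesWithin {P : RAM.Program} {ρ C : ℝ} {d : ℕ} (hρ : 0 < ρ) (hρ₂ : ρ < 2)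
    (hC : 0 ≤ C) (h : ∀ (n : ℕ) (φ : CNFFormula n), RAM.DecidesWithin P φ.encode φ.Satisfiable
      (C * ρ ^ n * (((n : ℝ) + 1) * φ.encode.length) ^ d)) : ¬ SETH := by
  obtain ⟨θ, hθ, hθ₂⟩ := exists_between (max_lt hρ₂ one_lt_two)
  obtain ⟨hρθ, hθ₁⟩ := max_lt_iff.1 hθ
  obtain ⟨D, hD, hDn⟩ := exists_pow_mul_pow_le hρ hρθ d
  refine fun hSETH => hSETH (2 - θ) (by linarith) (by linarith)
    ⟨P, max ⌈C * D⌉₊ d, fun n φ => (h n φ).mono ?_⟩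
  have hL : (1 : ℝ) ≤ φ.encode.length := Nat.one_le_cast.2 (Nat.succ_pos _)
  rw [sub_sub_cancel]
  calc C * ρ ^ n * (((n : ℝ) + 1) * φ.encode.length) ^ d
      = C * (ρ ^ n * ((n : ℝ) + 1) ^ d) * (φ.encode.length : ℝ) ^ d := by rw [mul_pow]; ring
    _ ≤ C * (D * θ ^ n) * (φ.encode.length : ℝ) ^ d := by
        gcongr C * ?_ * _
        exact hDn n
    _ = C * D * θ ^ n * (φ.encode.length : ℝ) ^ d := by ring
    _ ≤ (max ⌈C * D⌉₊ d : ℕ) * θ ^ n * (φ.encode.length : ℝ) ^ max ⌈C * D⌉₊ d := by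
        gcongr
        · exact (Nat.le_ceil _).trans (Nat.cast_le.2 (le_max_left _ _))
        · exact le_max_right _ _

namespace SatCover

open RAM LoopLang

variable {n k g Z : ℕ} {φ : CNFFormula n}

theorem getD_encode_le (φ : CNFFormula n) (a : ℕ) :
    φ.encode.getD a 0 ≤ 2 * n + φ.encode.length := by
  rcases lt_or_ge a φ.encode.length with ha | ha
  · rw [List.getD_eq_getElem _ _ ha]
    have hy := List.getElem_mem ha
    generalize φ.encode[a] = y at hy
    have hlen := length_add_two_le_length_cnfEncoding (n := n) (cs := codes φ)
    have hlen' {c : List ℕ} := length_le_length_cnfEncoding (n := n) (cs := codes φ) (c := c)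
    rw [encode_eq_cnfEncoding] at hy ⊢
    simp only [cnfEncoding, List.mem_cons, List.mem_flatMap] at hy
    rcases hy with rfl | rfl | ⟨c, hc, rfl | hy⟩
    · omega
    · omega
    · have := hlen' hc
      omega
    · simp only [codes, List.mem_map] at hc
      obtain ⟨C, -, rfl⟩ := hc
      obtain ⟨l, -, rfl⟩ := List.mem_map.1 hy
      have := l.1.2
      have := Bool.toNat_le l.2
      omega
  · rw [List.getD_eq_default _ _ ha]
    exact Nat.zero_le _

theorem log_cost_reduction_le {L : ℕ} (hk : 1 ≤ k) (hn : n ≤ k * g) (hZ : L + k + k * g ≤ Z) :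
    (7 + 3 * (2 * n + L + 250 * Z ^ 3 * 2 ^ g).size) * (250 * Z ^ 3 * 2 ^ g) ≤
      191500 * (Z ^ 6 * 2 ^ g) := by
  have hgZ : g ≤ Z := (Nat.le_mul_of_pos_left g hk).trans (by omega)
  have hZ₃ : Z ≤ Z ^ 3 := Nat.le_self_pow (by norm_num) Z
  have hsize : (2 * n + L + 250 * Z ^ 3 * 2 ^ g).size ≤ 253 * Z ^ 3 := by
    rw [Nat.size_le]
    calc 2 * n + L + 250 * Z ^ 3 * 2 ^ g ≤ 252 * Z ^ 3 * 2 ^ g := by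
          have : 2 * Z ^ 3 ≤ 2 * Z ^ 3 * 2 ^ g := Nat.le_mul_of_pos_right _ (by positivity)
          linarith [show 2 * n + L ≤ 2 * Z by omega]
      _ < 2 ^ (252 * Z ^ 3) * 2 ^ g := by gcongr; exact Nat.lt_two_pow_self
      _ ≤ 2 ^ (253 * Z ^ 3) := by
          rw [← pow_add]
          exact Nat.pow_le_pow_right two_pos (by omega)
  calc _ ≤ (766 * Z ^ 3) * (250 * Z ^ 3 * 2 ^ g) := by gcongr; omega
    _ = _ := by ring

theorem decidesWithin_reduction {P : Program} {p : Prop} {B : ℝ} (hk : 1 ≤ k) (hg : n / k + 1 = g)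
    (hZ : φ.encode.length + k + k * g ≤ Z)
    (h : DecidesWithin P (satEncoding k g (codes φ)) p B) :
    DecidesWithin ((reduction k).andThen P) φ.encode p
      ((191526 + (reduction k).size) * ((Z : ℝ) ^ 6 * 2 ^ g) + B) := by
  have hn : n ≤ k * g := hg ▸ (Nat.lt_mul_div_succ n hk).le
  have hrun : Runs (reduction k) (start φ.encode) (250 * Z ^ 3 * 2 ^ g)
      fun s => ∀ a, s.mem a = (satEncoding k g (codes φ)).getD a 0 :=
    runs_reduction (fun a => congrArg (List.getD · a 0) (encode_eq_cnfEncoding φ)) (fun _ => rfl)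
      hg hk (encode_eq_cnfEncoding φ ▸ hZ)
  refine (decidesWithin_andThen (getD_encode_le φ) hrun h).mono ?_
  have hone : 1 ≤ Z ^ 6 * 2 ^ g := Nat.mul_pos (Nat.pow_pos (by omega)) (by positivity)
  have hle := log_cost_reduction_le hk hn hZ
  gcongr
  norm_cast
  calc _ ≤ 191500 * (Z ^ 6 * 2 ^ g) + (26 + (reduction k).size) * (Z ^ 6 * 2 ^ g) :=
        Nat.add_le_add hle (Nat.le_mul_of_pos_right _ hone)
    _ = _ := by ring

theorem size_satInstance_le (hZ : φ.encode.length + k + k * g ≤ Z) :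
    ((satInstance k g φ).Obj.card : ℝ) + (satInstance k g φ).n ≤ 2 * Z * 2 ^ g := by
  have hn : (satInstance k g φ).n ≤ Z := by
    have := length_add_two_le_length_cnfEncoding (n := n) (cs := codes φ)
    rw [← encode_eq_cnfEncoding] at this
    change leaves k g (codes φ) + 1 ≤ Z
    rw [leaves]
    omega
  have hcard : (satInstance k g φ).Obj.card ≤ Z * 2 ^ g :=
    card_obj_satInstance_le.trans (Nat.mul_le_mul_right _ (by omega))
  norm_cast
  calc _ ≤ Z * 2 ^ g + Z * 2 ^ g :=
        Nat.add_le_add hcard (hn.trans (Nat.le_mul_of_pos_right _ (by positivity)))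
    _ = _ := by ring

theorem two_pow_rpow_le {s : ℝ} (hs : 0 ≤ s) (hsk : s ≤ k) :
    ((2 : ℝ) ^ (n / k + 1)) ^ s ≤ 2 ^ k * (2 ^ (s / k)) ^ n :=
  calc ((2 : ℝ) ^ (n / k + 1)) ^ s = (2 : ℝ) ^ s * 2 ^ (((n / k : ℕ) : ℝ) * s) := by
        rw [← Real.rpow_natCast, ← Real.rpow_mul two_pos.le, ← Real.rpow_add two_pos]
        push_cast
        ring_nf
    _ ≤ (2 : ℝ) ^ (k : ℝ) * 2 ^ (n / k * s) := by
        gcongr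
        · exact one_le_two
        · exact one_le_two
        · exact Nat.cast_div_le
    _ = 2 ^ k * (2 ^ (s / k)) ^ n := by
        rw [Real.rpow_natCast, ← Real.rpow_natCast (_ ^ _), ← Real.rpow_mul two_pos.le]
        ring_nf

theorem add_mul_div_le {L : ℕ} (hL : 1 ≤ L) :
    L + k + k * (n / k + 1) ≤ (2 * k + 1) * ((n + 1) * L) :=
  calc L + k + k * (n / k + 1) ≤ L + k + (n + k) := by
        rw [mul_add_one]
        gcongr
        exact Nat.mul_div_le n k
    _ = 2 * k + (n + L) := by ring
    _ ≤ 2 * k * ((n + 1) * L) + (n + 1) * L :=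
        Nat.add_le_add (Nat.le_mul_of_pos_right _ (Nat.mul_pos n.succ_pos hL)) (by nlinarith)
    _ = (2 * k + 1) * ((n + 1) * L) := by ring

theorem exists_decidesWithin_satisfiable (hk : 2 ≤ k) {s F : ℝ} (hs : 1 ≤ s) (hsk : s ≤ k)
    (hF : 0 ≤ F) : ∃ C : ℝ, 0 ≤ C ∧ ∀ (P : Program) (n : ℕ) (φ : CNFFormula n),
      DecidesWithin P (satEncoding k (n / k + 1) (codes φ))
        ((satInstance k (n / k + 1) φ).HasCover k)
        (F * ((satInstance k (n / k + 1) φ).Obj.card + (satInstance k (n / k + 1) φ).n) ^ s) →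
      DecidesWithin ((reduction k).andThen P) φ.encode φ.Satisfiable
        (C * (2 ^ (s / k)) ^ n * (((n : ℝ) + 1) * φ.encode.length) ^ (k + 6)) := by
  refine ⟨(191526 + (reduction k).size + F * 2 ^ k) * 2 ^ k * (2 * k + 1) ^ (k + 6),
    by positivity, fun P n φ h => ?_⟩
  set Z : ℕ := φ.encode.length + k + k * (n / k + 1) with hZ
  set ρ : ℝ := 2 ^ (s / k)
  have hρ := two_pow_rpow_le (n := n) (by linarith) hsk
  have hX : (2 : ℝ) ^ (n / k + 1) ≤ 2 ^ k * ρ ^ n :=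
    (Real.self_le_rpow_of_one_le (one_le_pow₀ one_le_two) hs).trans hρ
  have hZ₁ : (1 : ℝ) ≤ Z := Nat.one_le_cast.2 (by omega)
  have hsize := calc
    ((satInstance k (n / k + 1) φ).Obj.card + (satInstance k (n / k + 1) φ).n : ℝ) ^ s ≤
        (2 * Z * 2 ^ (n / k + 1)) ^ s := by gcongr; exact size_satInstance_le hZ.ge
    _ = (2 * Z) ^ s * (2 ^ (n / k + 1)) ^ s := Real.mul_rpow (by positivity) (by positivity)
    _ ≤ (2 * Z) ^ (k : ℝ) * (2 ^ k * ρ ^ n) := by gcongr; linarith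
    _ = 2 ^ k * (Z ^ k * (2 ^ k * ρ ^ n)) := by rw [Real.rpow_natCast, mul_pow, mul_assoc]
  have hZA : (Z : ℝ) ≤ (2 * k + 1) * ((n + 1) * φ.encode.length) := by
    exact_mod_cast add_mul_div_le (Nat.succ_pos _)
  rw [← hasCover_satInstance_iff hk (Nat.lt_mul_div_succ n (by omega)).le]
  refine (decidesWithin_reduction (by omega) rfl hZ.ge h).mono ?_
  calc _ ≤ (191526 + (reduction k).size) * ((Z : ℝ) ^ 6 * (2 ^ k * ρ ^ n)) +
        F * (2 ^ k * (Z ^ k * (2 ^ k * ρ ^ n))) := by gcongr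
    _ ≤ (191526 + (reduction k).size) * ((Z : ℝ) ^ (k + 6) * (2 ^ k * ρ ^ n)) +
        F * (2 ^ k * (Z ^ (k + 6) * (2 ^ k * ρ ^ n))) := by
        gcongr <;> first | exact hZ₁ | omega
    _ = (191526 + (reduction k).size + F * 2 ^ k) * 2 ^ k * ρ ^ n * (Z : ℝ) ^ (k + 6) := by ring
    _ ≤ (191526 + (reduction k).size + F * 2 ^ k) * 2 ^ k * ρ ^ n *
        ((2 * k + 1) * ((n + 1) * φ.encode.length)) ^ (k + 6) := by gcongr
    _ = _ := by rw [mul_pow]; ring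

end SatCover

/-- `K` is the set of parameter values for which the algorithm is required to work, so that
`K = Set.univ` is the claim for algorithms that take an arbitrary `k`, and `K = {k}` is the claim
for a single fixed `k`. The function `f` need not be computable. -/
theorem mainTheorem12 (hSETH : SETH) (f : ℕ → ℕ) (ε : ℝ) (hε : 0 < ε)
    (K : Set ℕ) (hK : ∃ k ∈ K, 2 ≤ k) :
    ¬ ∃ P : RAM.Program, ∀ k ∈ K, ∀ (I : PlanarCoverInstance) (x : List ℕ),
      I.IsEncoding k x →
        RAM.DecidesWithin P x (I.HasCover k)
          (f k * ((I.Obj.card : ℝ) + (I.n : ℝ)) ^ ((k : ℝ) - ε)) := by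
  rintro ⟨P, hP⟩
  obtain ⟨k, hkK, hk⟩ := hK
  have hk₁ : (1 : ℝ) < k := Nat.one_lt_cast.2 hk
  -- Exponents below `1` are raised to `1`: writing down the instance takes linear time anyway.
  obtain ⟨s, hs, hsk⟩ : ∃ s, max 1 (k - ε) ≤ s ∧ s < (k : ℝ) :=
    ⟨_, le_rfl, max_lt hk₁ (by linarith)⟩
  obtain ⟨hs₁, hsε⟩ := max_le_iff.1 hs
  have hρ : (2 : ℝ) ^ (s / k) < 2 :=
    Real.rpow_lt_self_of_one_lt one_lt_two ((div_lt_one (by linarith)).2 hsk)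
  obtain ⟨C, hC, hdec⟩ := SatCover.exists_decidesWithin_satisfiable hk hs₁ hsk.le (f k).cast_nonneg
  refine not_SETH_of_decidesWithin (by positivity) hρ hC (fun n φ => hdec P n φ ?_) hSETH
  refine (hP k hkK _ _ SatCover.isEncoding_satEncoding).mono ?_
  have hn : (1 : ℝ) ≤ (SatCover.satInstance k (n / k + 1) φ).n :=
    Nat.one_le_cast.2 (PlanarCoverInstance.n_pos _)
  gcongr
  exact le_add_of_nonneg_of_le (Nat.cast_nonneg _) hn
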